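/- **Setting.** Let $\mathsf F$ be a skew field, $\sigma$ an automorphism of $\mathsf F$ and $\delta$ a $\sigma$-derivation, i.e. $\delta$ is additive and $\delta(ab)=\sigma(a)\delta(b)+\delta(a)b$. Let $R=\mathsf F[\partial;\sigma,\delta]$ be the ring of Ore polynomials $\sum_k a_k\partial^k$ with $\partial a=\sigma(a)\partial+\delta(a)$ for $a\in\mathsf F$, and let $\deg$ be the degree in $\partial$, with $\deg 0=-\infty$. A matrix $A\in R^{n\times n}$ has full rank if its rows are left linearly independent over $R$. A matrix $U\in R^{n\times n}$ is unimodular if it has a two-sided inverse in $R^{n\times n}$. A full-rank matrix $H\in R^{n\times n}$ is in Hermite form if it is upper triangular, its diagonal entries are monic, and each diagonal entry has strictly larger degree than every entry above it in its column. A Hermite form of $A$ is a matrix $H=UA$ in Hermite form with $U$ unimodular. An operation in $\mathsf F$ is an addition, subtraction, multiplication, inversion, an application of $\sigma$ or $\delta$, a test for zero, or storing a constant $0$, $1$ or a copy of an element; each has unit cost. Integer arithmetic used for control and addressing is not counted. **Theorem.** There are a deterministic algorithm and a constant $C$, both independent of $\mathsf F,\sigma,\delta,n,d$ and of the input matrix,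 such that for all $\mathsf F,\sigma,\delta$ as above, all integers $n\ge 1$ and $d\geq 0$, and every $A\in R^{n\times n}$ of full rank with all entries of degree less than $d$, the algorithm, given $n$, $d$ and the coefficients of the entries of $A$, computes matrices $U,H\in R^{n\times n}$ such that $U$ is unimodular, $UA=H$, and $H$ is in Hermite form, using at most $$C\,n^7d^3\max\{1,\log(nd)\}$$ operations in $\mathsf F$. (Necessarily $d\ge1$.) -/

import Mathlib

/-! ### Ore polynomials over a skew field -/

/-- A `σ`-derivation of the skew field `F`: an additive map `δ` with
`δ (a b) = σ a δ b + δ a b`. -/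
structure SkewDerivation {F : Type*} [DivisionRing F] (σ : F ≃+* F) extends F →+ F where
  leibniz : ∀ a b : F, toFun (a * b) = σ a * toFun b + toFun a * b

namespace SkewDerivation

variable {F : Type*} [DivisionRing F] {σ : F ≃+* F}

instance : CoeFun (SkewDerivation σ) fun _ => F → F := ⟨fun δ => δ.toAddMonoidHom⟩

theorem map_mul (δ : SkewDerivation σ) (a b : F) : δ (a * b) = σ a * δ b + δ a * b :=
  δ.leibniz a b

theorem map_one (δ : SkewDerivation σ) : δ 1 = 0 := by
  simpa using δ.map_mul 1 1

end SkewDerivation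

/-- The Ore polynomials `F[∂; σ, δ]`: the element `∑ aₖ ∂ᵏ` is given by its finitely supported
coefficient sequence. -/
@[ext]
structure OrePoly {F : Type*} [DivisionRing F] {σ : F ≃+* F} (δ : SkewDerivation σ) where
  coeffs : ℕ →₀ F

namespace OrePoly

variable {F : Type*} [DivisionRing F] {σ : F ≃+* F} (δ : SkewDerivation σ)

/-- The monomial `a ∂ᵏ`. -/
noncomputable def monomial (k : ℕ) (a : F) : OrePoly δ := ⟨Finsupp.single k a⟩

/-- Left multiplication by `∂`, on coefficient sequences:
`a ∂ᵏ ↦ σ(a) ∂ᵏ⁺¹ + δ(a) ∂ᵏ`, extended additively. -/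
noncomputable def dMul : AddMonoid.End (ℕ →₀ F) :=
  Finsupp.liftAddHom fun k =>
    (Finsupp.singleAddHom (k + 1)).comp (σ : F →+ F) +
      (Finsupp.singleAddHom k).comp δ.toAddMonoidHom

/-- Multiplication on coefficient sequences: `∑ aₖ ∂ᵏ` acts on the left as `g ↦ ∑ aₖ (∂ᵏ g)`. -/
noncomputable def lMul : (ℕ →₀ F) →+ AddMonoid.End (ℕ →₀ F) :=
  Finsupp.liftAddHom fun k =>
    (AddMonoidHom.mulRight (dMul δ ^ k)).comp (Module.toAddMonoidEnd F (ℕ →₀ F)).toAddMonoidHom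

theorem dMul_single (k : ℕ) (a : F) :
    dMul δ (Finsupp.single k a) = Finsupp.single (k + 1) (σ a) + Finsupp.single k (δ a) :=
  Finsupp.liftAddHom_apply_single _ k a

theorem lMul_single (k : ℕ) (a : F) (g : ℕ →₀ F) :
    lMul δ (Finsupp.single k a) g = a • (dMul δ ^ k) g :=
  DFunLike.congr_fun (Finsupp.liftAddHom_apply_single _ k a) g

theorem lMul_add (f g h : ℕ →₀ F) : lMul δ (f + g) h = lMul δ f h + lMul δ g h := by
  rw [map_add]; rfl

theorem lMul_zero (h : ℕ →₀ F) : lMul δ 0 h = 0 := by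
  rw [map_zero]; rfl

theorem dMul_pow_succ (k : ℕ) (g : ℕ →₀ F) : (dMul δ ^ (k + 1)) g = dMul δ ((dMul δ ^ k) g) := by
  rw [pow_succ']; rfl

theorem dMul_smul (a : F) (g : ℕ →₀ F) : dMul δ (a • g) = σ a • dMul δ g + δ a • g := by
  induction g using Finsupp.induction_linear with
  | zero => simp
  | add f g hf hg => simp only [smul_add, map_add, hf, hg]; abel
  | single k b =>
    rw [Finsupp.smul_single, dMul_single, dMul_single, smul_eq_mul, δ.map_mul, _root_.map_mul,
      smul_add, Finsupp.smul_single, Finsupp.smul_single, Finsupp.smul_single, Finsupp.single_add]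
    simp only [smul_eq_mul, add_assoc]

theorem lMul_dMul (g h : ℕ →₀ F) : lMul δ (dMul δ g) h = dMul δ (lMul δ g h) := by
  induction g using Finsupp.induction_linear with
  | zero => simp
  | add f g hf hg => rw [map_add, lMul_add, lMul_add, map_add, hf, hg]
  | single k b =>
    rw [dMul_single, lMul_add, lMul_single, lMul_single, lMul_single, dMul_smul, dMul_pow_succ]

theorem lMul_dMul_pow (k : ℕ) (g h : ℕ →₀ F) :
    lMul δ ((dMul δ ^ k) g) h = (dMul δ ^ k) (lMul δ g h) := by
  induction k with
  | zero => simp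
  | succ k ih => rw [dMul_pow_succ, dMul_pow_succ, lMul_dMul, ih]

theorem lMul_smul (a : F) (g h : ℕ →₀ F) : lMul δ (a • g) h = a • lMul δ g h := by
  induction g using Finsupp.induction_linear with
  | zero => simp
  | add f g hf hg => rw [smul_add, lMul_add, lMul_add, smul_add, hf, hg]
  | single k b => rw [Finsupp.smul_single, lMul_single, lMul_single, smul_eq_mul, mul_smul]

theorem lMul_assoc (f g h : ℕ →₀ F) : lMul δ (lMul δ f g) h = lMul δ f (lMul δ g h) := by
  induction f using Finsupp.induction_linear with
  | zero => simp
  | add f f' hf hf' => rw [lMul_add, lMul_add, lMul_add, hf, hf']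
  | single k b => rw [lMul_single, lMul_smul, lMul_dMul_pow, lMul_single]

theorem dMul_pow_one (k : ℕ) : (dMul δ ^ k) (Finsupp.single 0 1) = Finsupp.single k 1 := by
  induction k with
  | zero => simp
  | succ k ih => rw [dMul_pow_succ, ih, dMul_single, δ.map_one]; simp

theorem lMul_one (f : ℕ →₀ F) : lMul δ f (Finsupp.single 0 1) = f := by
  induction f using Finsupp.induction_linear with
  | zero => simp
  | add f f' hf hf' => rw [lMul_add, hf, hf']
  | single k b => rw [lMul_single, dMul_pow_one]; simp

theorem one_lMul (f : ℕ →₀ F) : lMul δ (Finsupp.single 0 1) f = f := by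
  rw [lMul_single]; simp

noncomputable instance : Zero (OrePoly δ) := ⟨⟨0⟩⟩
noncomputable instance : One (OrePoly δ) := ⟨monomial δ 0 1⟩
noncomputable instance : Add (OrePoly δ) := ⟨fun f g => ⟨f.coeffs + g.coeffs⟩⟩
noncomputable instance : Neg (OrePoly δ) := ⟨fun f => ⟨-f.coeffs⟩⟩
noncomputable instance : Mul (OrePoly δ) := ⟨fun f g => ⟨lMul δ f.coeffs g.coeffs⟩⟩

/-- The ring `F[∂; σ, δ]`. -/
noncomputable instance : Ring (OrePoly δ) where
  add_assoc f g h := OrePoly.ext (add_assoc f.coeffs g.coeffs h.coeffs)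
  zero_add f := OrePoly.ext (zero_add f.coeffs)
  add_zero f := OrePoly.ext (add_zero f.coeffs)
  add_comm f g := OrePoly.ext (add_comm f.coeffs g.coeffs)
  neg_add_cancel f := OrePoly.ext (neg_add_cancel f.coeffs)
  nsmul := nsmulRec
  zsmul := zsmulRec
  left_distrib f g h := OrePoly.ext (map_add (lMul δ f.coeffs) g.coeffs h.coeffs)
  right_distrib f g h := OrePoly.ext (lMul_add δ f.coeffs g.coeffs h.coeffs)
  zero_mul f := OrePoly.ext (lMul_zero δ f.coeffs)
  mul_zero f := OrePoly.ext (map_zero (lMul δ f.coeffs))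
  mul_assoc f g h := OrePoly.ext (lMul_assoc δ f.coeffs g.coeffs h.coeffs)
  one_mul f := OrePoly.ext (one_lMul δ f.coeffs)
  mul_one f := OrePoly.ext (lMul_one δ f.coeffs)

/-- The defining commutation rule `∂ a = σ(a) ∂ + δ(a)`. -/
theorem d_mul_const (a : F) :
    monomial δ 1 1 * monomial δ 0 a =
      monomial δ 0 (σ a) * monomial δ 1 1 + monomial δ 0 (δ a) := by
  apply OrePoly.ext
  change lMul δ (Finsupp.single 1 1) (Finsupp.single 0 a) =
    lMul δ (Finsupp.single 0 (σ a)) (Finsupp.single 1 1) + Finsupp.single 0 (δ a)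
  rw [lMul_single, lMul_single, pow_one, dMul_single]
  simp

/-- The monomial `a ∂ᵏ` is the product of the constant `a` and the `k`-th power of `∂`. -/
theorem monomial_eq (k : ℕ) (a : F) :
    monomial δ k a = monomial δ 0 a * monomial δ 1 1 ^ k := by
  have hk : monomial δ 1 1 ^ k = monomial δ k 1 := by
    induction k with
    | zero => rfl
    | succ k ih =>
      rw [pow_succ', ih]
      apply OrePoly.ext
      change lMul δ (Finsupp.single 1 1) (Finsupp.single k 1) = Finsupp.single (k + 1) 1
      rw [lMul_single, pow_one, one_smul, ← dMul_pow_one δ k, ← dMul_pow_one δ (k + 1),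
        dMul_pow_succ]
  rw [hk]
  apply OrePoly.ext
  change Finsupp.single k a = lMul δ (Finsupp.single 0 a) (Finsupp.single k 1)
  rw [lMul_single]
  simp

variable {δ}

/-- The coefficient of `∂ᵏ`. -/
def coeff (f : OrePoly δ) (k : ℕ) : F := f.coeffs k

/-- The degree in `∂`; the zero polynomial has degree `⊥`. -/
def deg (f : OrePoly δ) : WithBot ℕ := f.coeffs.support.max

/-- `f` is nonzero with leading coefficient `1`. -/
def Monic (f : OrePoly δ) : Prop := ∃ k : ℕ, f.deg = k ∧ f.coeff k = 1

/-- A square matrix is in (row) Hermite form of full rank: it is upper triangular, its diagonal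
entries are monic, and each diagonal entry has larger degree than the entries above it. -/
structure IsHermite {n : ℕ} (H : Matrix (Fin n) (Fin n) (OrePoly δ)) : Prop where
  upper : ∀ i j, j < i → H i j = 0
  monic : ∀ i, (H i i).Monic
  reduced : ∀ i j, i < j → (H i j).deg < (H j j).deg

/-- The rows are left linearly independent. -/
def FullRank {n : ℕ} (A : Matrix (Fin n) (Fin n) (OrePoly δ)) : Prop :=
  LinearIndependent (OrePoly δ) A.row

end OrePoly

/-! ### Programs over a skew field with `σ` and `δ`

One program text serves all skew fields. It has integer registers, used for control and for
addresses, and arrays (of any number of dimensions) of elements of `F`. Elements of `F` are accessed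
only by the instructions below, and influence the control only through zero tests. -/

/-- Integer expressions over the registers. -/
inductive IndexExpr where
  | lit (c : ℕ)
  | reg (r : ℕ)
  | add (e f : IndexExpr)
  | sub (e f : IndexExpr)
  | mul (e f : IndexExpr)
  | div (e f : IndexExpr)

/-- The array element `array[idx₁, …, idxₘ]`. -/
structure Cell where
  array : ℕ
  idx : List IndexExpr

/-- The right-hand sides of assignments to array elements. -/
inductive FieldOp where
  | zero
  | one
  | copy (x : Cell)
  | add (x y : Cell)
  | sub (x y : Cell)
  | mul (x y : Cell)
  | inv (x : Cell)
  | sigma (x : Cell)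
  | delta (x : Cell)

/-- Programs: assignments to registers and to array elements, composition, branching on a comparison
of integers or on a zero test in `F`, and counted loops `for r = 0, …, e - 1`. -/
inductive Prog where
  | skip
  | setReg (r : ℕ) (e : IndexExpr)
  | assign (x : Cell) (op : FieldOp)
  | seq (p q : Prog)
  | ifLt (e f : IndexExpr) (p q : Prog)
  | ifZero (x : Cell) (p q : Prog)
  | loop (r : ℕ) (e : IndexExpr) (p : Prog)

/-- A configuration of the memory. -/
structure Memory (F : Type*) where
  reg : ℕ → ℕ
  arr : ℕ → List ℕ → F

/-- The value of an integer expression (subtraction truncated, division rounded down). -/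
def IndexExpr.eval (s : ℕ → ℕ) : IndexExpr → ℕ
  | lit c => c
  | reg r => s r
  | add e f => e.eval s + f.eval s
  | sub e f => e.eval s - f.eval s
  | mul e f => e.eval s * f.eval s
  | div e f => e.eval s / f.eval s

namespace Memory

variable {F : Type*}

/-- Read an array element. -/
def get (s : Memory F) (x : Cell) : F := s.arr x.array (x.idx.map (IndexExpr.eval s.reg))

/-- Overwrite an array element. -/
def set (s : Memory F) (x : Cell) (v : F) : Memory F :=
  { s with
    arr := Function.update s.arr x.array
      (Function.update (s.arr x.array) (x.idx.map (IndexExpr.eval s.reg)) v) }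

/-- Overwrite a register. -/
def setReg (s : Memory F) (r v : ℕ) : Memory F := { s with reg := Function.update s.reg r v }

end Memory

/-- The value of a right-hand side. -/
def FieldOp.eval {F : Type*} [DivisionRing F] {σ : F ≃+* F} (δ : SkewDerivation σ) (s : Memory F) :
    FieldOp → F
  | zero => 0
  | one => 1
  | copy x => s.get x
  | add x y => s.get x + s.get y
  | sub x y => s.get x - s.get y
  | mul x y => s.get x * s.get y
  | inv x => (s.get x)⁻¹
  | sigma x => σ (s.get x)
  | delta x => δ (s.get x)

open Classical in
/-- Running a program: the final memory and the number of operations in `F`. Each assignment to an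
array element (even of a constant or a copy) and each zero test in `F` counts as one operation. -/
noncomputable def Prog.run {F : Type*} [DivisionRing F] {σ : F ≃+* F} (δ : SkewDerivation σ) :
    Prog → Memory F → Memory F × ℕ
  | skip, s => (s, 0)
  | setReg r e, s => (s.setReg r (e.eval s.reg), 0)
  | assign x op, s => (s.set x (op.eval δ s), 1)
  | seq p q, s =>
    let a := p.run δ s
    let b := q.run δ a.1
    (b.1, a.2 + b.2)
  | ifLt e f p q, s => if e.eval s.reg < f.eval s.reg then p.run δ s else q.run δ s
  | ifZero x p q, s =>
    let a := if s.get x = 0 then p.run δ s else q.run δ s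
    (a.1, a.2 + 1)
  | loop r e p, s =>
    Nat.rec (s, 0)
      (fun t a =>
        let b := p.run δ (a.1.setReg r t)
        (b.1, a.2 + b.2))
      (e.eval s.reg)

namespace OrePoly

variable {F : Type*} [DivisionRing F] {σ : F ≃+* F} {δ : SkewDerivation σ}

/-- The initial memory for the input `n`, `d`, `A`: the registers `0` and `1` hold `n` and `d`, and
array `0` holds at `[i, j, k]` the coefficient of `∂ᵏ` in `A i j`, for `i, j < n` and `k < d`.
Everything else is zero. -/
def input (n d : ℕ) (A : Matrix (Fin n) (Fin n) (OrePoly δ)) : Memory F where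
  reg r := if r = 0 then n else if r = 1 then d else 0
  arr a idx :=
    match a, idx with
    | 0, [i, j, k] =>
      if h : i < n ∧ j < n ∧ k < d then (A ⟨i, h.1⟩ ⟨j, h.2.1⟩).coeff k else 0
    | _, _ => 0

/-- The `n × n` matrix held by array `a`, where register `2` holds the number `ℓ` of coefficients
of each entry: entry `(i, j)` is `∑ k < ℓ, a[i, j, k] ∂ᵏ`. -/
noncomputable def output (δ : SkewDerivation σ) (n : ℕ) (s : Memory F) (a : ℕ) :
    Matrix (Fin n) (Fin n) (OrePoly δ) :=
  Matrix.of fun i j => ∑ k ∈ Finset.range (s.reg 2), monomial δ k (s.arr a [i, j, k])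

end OrePoly

/-! Once degrees are bounded, the Hermite form is a matter of Gaussian elimination over `F`.

The bounds come from counting dimensions (`exists_syzygy`). If `v` has degree at most `e`, there are
`w ≠ 0` and `u` with `u A = w v`, `deg w ≤ n d` and `deg u ≤ n d - d + e`: there is one more unknown
coefficient than there are equations, and full rank excludes `w = 0`. For `v` a unit vector this
shows that the diagonal degrees `h j` of the Hermite form are at most `n d`. For `v = u' A` it
bounds `u'`, since `u = w u'` and degrees add (`degLT_of_vecMul_eq`). The Hermite form itself is
obtained abstractly, from vectors of least degree in the row module (`exists_isHermiteBasis`). Its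
entries have degree at most `n d`, so its rows are `F`-combinations of the vectors `∂ᵗ Aᵢ` with `t <
2 n d`, all of degree less than `3 n d` (`mem_tableSpan_of_forall_X_pow`).

Order the coefficient positions of a row vector by entry, and by descending power within an entry,
and bring the vectors `∂ᵗ Aᵢ` into echelon form over `F`. The leading position of every vector of
the span is then a pivot. Minimality of `h j` makes `(j, h j)` the last pivot in entry `j`. The
pivot row there, cleared at all pivots of later entries, is row `j` of the Hermite form, because the
difference lies in the span and vanishes at every pivot (`IsEchelon.rowPart_eq`).

Each vector carries the multipliers that express it by the rows of `A`, and these yield `U`.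
Conversely the rows of `A` are combinations of those of `H`, and since both matrices can be
cancelled on the right, `U` is invertible (`IsHermiteBasis.isUnit_of_mul_eq`).

There are `2 n² d` insertions, each visits `3 n² d` positions, and each position costs a bounded
number of passes over `6 n² d` coefficients; hence `O(n⁶ d³)` operations. The program is verified by
Hoare-style triples `Meets`, which bound the cost along with the result. -/

namespace OrePoly

variable {F : Type*} [DivisionRing F] {σ : F ≃+* F} {δ : SkewDerivation σ}

/-! ### Coefficients and degree bounds -/

/-- `F` acts on Ore polynomials by left multiplication on the coefficients. -/
noncomputable instance : Module F (OrePoly δ) where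
  smul a f := ⟨a • f.coeffs⟩
  one_smul f := OrePoly.ext (one_smul F f.coeffs)
  mul_smul a b f := OrePoly.ext (mul_smul a b f.coeffs)
  smul_zero a := OrePoly.ext (smul_zero a)
  smul_add a f g := OrePoly.ext (smul_add a f.coeffs g.coeffs)
  add_smul a b f := OrePoly.ext (add_smul a b f.coeffs)
  zero_smul f := OrePoly.ext (zero_smul F f.coeffs)

instance : IsScalarTower F (OrePoly δ) (OrePoly δ) :=
  ⟨fun a f g => OrePoly.ext (lMul_smul δ a f.coeffs g.coeffs)⟩

/-- The coefficient of `∂ᵏ` as a linear form. -/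
def lcoeff (δ : SkewDerivation σ) (k : ℕ) : OrePoly δ →ₗ[F] F where
  toFun f := f.coeff k
  map_add' _ _ := rfl
  map_smul' _ _ := rfl

theorem ext_coeff {f g : OrePoly δ} (h : ∀ k, f.coeff k = g.coeff k) : f = g :=
  OrePoly.ext (Finsupp.ext h)

@[simp] theorem coeff_zero (k : ℕ) : (0 : OrePoly δ).coeff k = 0 := rfl

@[simp] theorem coeff_smul (a : F) (f : OrePoly δ) (k : ℕ) : (a • f).coeff k = a * f.coeff k := rfl

@[simp] theorem coeff_sub (f g : OrePoly δ) (k : ℕ) : (f - g).coeff k = f.coeff k - g.coeff k :=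
  map_sub (lcoeff δ k) f g

theorem coeff_sum {ι : Type*} (s : Finset ι) (f : ι → OrePoly δ) (k : ℕ) :
    (∑ i ∈ s, f i).coeff k = ∑ i ∈ s, (f i).coeff k :=
  map_sum (lcoeff δ k) f s

theorem coeff_monomial (k : ℕ) (a : F) (m : ℕ) :
    (monomial δ k a).coeff m = if k = m then a else 0 :=
  Finsupp.single_apply

theorem coeff_one (m : ℕ) : (1 : OrePoly δ).coeff m = if 0 = m then 1 else 0 :=
  coeff_monomial 0 1 m

/-- `f` has degree less than `m`. -/
def DegLT (m : ℕ) (f : OrePoly δ) : Prop := ∀ k, m ≤ k → f.coeff k = 0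

theorem deg_lt_iff {f : OrePoly δ} {m : ℕ} : f.deg < (m : WithBot ℕ) ↔ DegLT m f := by
  rw [Nat.cast_withBot]
  refine (Finset.sup_lt_iff (WithBot.bot_lt_coe m)).trans
    ⟨fun h k hk => ?_, fun h k hk => WithBot.coe_lt_coe.mpr ?_⟩
  · by_contra hne
    have := h k (Finsupp.mem_support_iff.mpr hne)
    exact absurd (WithBot.coe_lt_coe.mp this) (not_lt.mpr hk)
  · by_contra hle
    exact Finsupp.mem_support_iff.mp hk (h k (not_lt.mp hle))

theorem deg_eq_of_degLT {f : OrePoly δ} {m : ℕ} (h : DegLT (m + 1) f) (hm : f.coeff m ≠ 0) :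
    f.deg = (m : WithBot ℕ) := by
  refine le_antisymm (Finset.sup_le fun k hk => ?_)
    (Finset.le_max (Finsupp.mem_support_iff.mpr hm))
  rw [Nat.cast_withBot, WithBot.coe_le_coe]
  by_contra hlt
  exact Finsupp.mem_support_iff.mp hk (h k (by omega))

namespace DegLT

variable {m m' : ℕ} {f g : OrePoly δ}

theorem mono (h : DegLT m f) (hm : m ≤ m') : DegLT m' f := fun k hk => h k (hm.trans hk)

theorem sub (hf : DegLT m f) (hg : DegLT m g) : DegLT m (f - g) := fun k hk => by
  rw [coeff_sub, hf k hk, hg k hk, sub_zero]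

theorem smul (a : F) (hf : DegLT m f) : DegLT m (a • f) := fun k hk => by
  rw [coeff_smul, hf k hk, mul_zero]

theorem sum {ι : Type*} {s : Finset ι} {f : ι → OrePoly δ} (h : ∀ i ∈ s, DegLT m (f i)) :
    DegLT m (∑ i ∈ s, f i) := fun k hk => by
  rw [coeff_sum]
  exact Finset.sum_eq_zero fun i hi => h i hi k hk

theorem zero : DegLT m (0 : OrePoly δ) := fun _ _ => rfl

theorem eq_zero (h : DegLT 0 f) : f = 0 := ext_coeff fun k => h k (Nat.zero_le k)

end DegLT

theorem exists_leading {f : OrePoly δ} (hf : f ≠ 0) :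
    ∃ a, DegLT (a + 1) f ∧ f.coeff a ≠ 0 := by
  have hs : f.coeffs.support.Nonempty := by
    rw [Finsupp.support_nonempty_iff]
    exact fun h => hf (OrePoly.ext h)
  refine ⟨f.coeffs.support.max' hs, fun k hk => ?_,
    Finsupp.mem_support_iff.mp (Finset.max'_mem _ hs)⟩
  by_contra hne
  have := Finset.le_max' _ k (Finsupp.mem_support_iff.mpr hne)
  omega

/-! ### Multiplication and degrees -/

theorem dMul_apply_succ (g : ℕ →₀ F) (k : ℕ) :
    dMul δ g (k + 1) = σ (g k) + δ (g (k + 1)) := by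
  induction g using Finsupp.induction_linear with
  | zero => simp
  | add f g hf hg => simp only [map_add, Finsupp.add_apply, hf, hg]; abel
  | single m a =>
    rw [dMul_single]
    simp only [Finsupp.add_apply, Finsupp.single_apply, add_left_inj]
    split_ifs <;> simp

theorem dMul_apply_zero (g : ℕ →₀ F) : dMul δ g 0 = δ (g 0) := by
  induction g using Finsupp.induction_linear with
  | zero => simp
  | add f g hf hg => simp only [map_add, Finsupp.add_apply, hf, hg]
  | single m a =>
    rw [dMul_single]
    simp only [Finsupp.add_apply, Finsupp.single_apply]
    split_ifs <;> simp_all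

/-- The indeterminate `∂`. -/
noncomputable def X (δ : SkewDerivation σ) : OrePoly δ := monomial δ 1 1

theorem X_mul_coeffs (f : OrePoly δ) : (X δ * f).coeffs = dMul δ f.coeffs := by
  change lMul δ (Finsupp.single 1 1) f.coeffs = _
  rw [lMul_single, pow_one, one_smul]

theorem coeff_X_mul_succ (f : OrePoly δ) (k : ℕ) :
    (X δ * f).coeff (k + 1) = σ (f.coeff k) + δ (f.coeff (k + 1)) := by
  unfold coeff
  rw [X_mul_coeffs, dMul_apply_succ]

theorem coeff_X_mul_zero (f : OrePoly δ) : (X δ * f).coeff 0 = δ (f.coeff 0) := by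
  unfold coeff
  rw [X_mul_coeffs, dMul_apply_zero]

theorem X_pow_coeffs (k : ℕ) (f : OrePoly δ) :
    (X δ ^ k * f).coeffs = (dMul δ ^ k) f.coeffs := by
  induction k with
  | zero => simp
  | succ k ih => rw [pow_succ', mul_assoc, X_mul_coeffs, ih, dMul_pow_succ]

theorem DegLT.X_mul {m : ℕ} {f : OrePoly δ} (h : DegLT m f) : DegLT (m + 1) (X δ * f) := by
  intro k hk
  obtain ⟨k, rfl⟩ : ∃ l, k = l + 1 := ⟨k - 1, by omega⟩
  rw [coeff_X_mul_succ, h k (by omega), h (k + 1) (by omega)]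
  simp

theorem DegLT.X_pow_mul {m : ℕ} {f : OrePoly δ} (h : DegLT m f) (k : ℕ) :
    DegLT (m + k) (X δ ^ k * f) := by
  induction k with
  | zero => simpa using h
  | succ k ih =>
    rw [pow_succ', mul_assoc]
    exact ih.X_mul

/-- In the top coefficient `δ` is applied only to a coefficient beyond the degree, which is zero, so
each factor `∂` just twists by `σ`. -/
theorem coeff_X_pow_mul {m : ℕ} {f : OrePoly δ} (h : DegLT (m + 1) f) (k : ℕ) :
    (X δ ^ k * f).coeff (m + k) = (σ ^ k) (f.coeff m) := by
  induction k with
  | zero => simp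
  | succ k ih =>
    have hz : (X δ ^ k * f).coeff (m + k + 1) = 0 := h.X_pow_mul k _ (by omega)
    rw [pow_succ', mul_assoc, ← add_assoc, coeff_X_mul_succ, ih, hz, pow_succ']
    simp

theorem eq_sum_X_pow {m : ℕ} {f : OrePoly δ} (h : DegLT m f) :
    f = ∑ k ∈ Finset.range m, f.coeff k • X δ ^ k := by
  have hX : ∀ k, (X δ ^ k).coeffs = Finsupp.single k 1 := fun k => by
    rw [← mul_one (X δ ^ k), X_pow_coeffs]
    exact dMul_pow_one δ k
  refine ext_coeff fun k => ?_
  have hc : ∀ i, (X δ ^ i).coeff k = if i = k then 1 else 0 := fun i => by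
    unfold coeff
    rw [hX, Finsupp.single_apply]
  simp only [coeff_sum, coeff_smul, hc, mul_ite, mul_one, mul_zero, Finset.sum_ite_eq',
    Finset.mem_range]
  split_ifs with hk
  · rfl
  · exact h k (not_lt.mp hk)

theorem DegLT.mul {a b : ℕ} {f g : OrePoly δ} (hf : DegLT (a + 1) f) (hg : DegLT b g) :
    DegLT (a + b) (f * g) := by
  rw [eq_sum_X_pow hf, Finset.sum_mul]
  refine DegLT.sum fun i hi => ?_
  rw [smul_mul_assoc]
  exact ((hg.X_pow_mul i).smul _).mono (by have := Finset.mem_range.mp hi; omega)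

theorem coeff_mul_top {a b : ℕ} {f g : OrePoly δ} (hf : DegLT (a + 1) f)
    (hg : DegLT (b + 1) g) : (f * g).coeff (a + b) = f.coeff a * (σ ^ a) (g.coeff b) := by
  conv_lhs => rw [eq_sum_X_pow hf, Finset.sum_mul]
  rw [coeff_sum, Finset.sum_eq_single a]
  · rw [smul_mul_assoc, coeff_smul, add_comm, coeff_X_pow_mul hg]
  · intro i hi hia
    rw [smul_mul_assoc, coeff_smul, hg.X_pow_mul i _ (by have := Finset.mem_range.mp hi; omega),
      mul_zero]
  · simp

/-- Degrees add because `σ` is injective and `F` has no zero divisors. This makes the ring a domain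
and lets a degree bound on a product pass to a factor. -/
theorem coeff_mul_top_ne_zero {a b : ℕ} {f g : OrePoly δ} (hf : DegLT (a + 1) f)
    (hg : DegLT (b + 1) g) (ha : f.coeff a ≠ 0) (hb : g.coeff b ≠ 0) :
    (f * g).coeff (a + b) ≠ 0 := by
  rw [coeff_mul_top hf hg]
  exact mul_ne_zero ha ((map_ne_zero_iff _ (σ ^ a).injective).mpr hb)

theorem DegLT.of_mul_left {m : ℕ} {f g : OrePoly δ} (hf : f ≠ 0) (h : DegLT m (f * g)) :
    DegLT m g := by
  rcases eq_or_ne g 0 with rfl | hg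
  · exact DegLT.zero
  obtain ⟨a, ha, ha'⟩ := exists_leading hf
  obtain ⟨b, hb, hb'⟩ := exists_leading hg
  have : a + b < m := by
    by_contra hle
    exact coeff_mul_top_ne_zero ha hb ha' hb' (h _ (not_lt.mp hle))
  exact hb.mono (by omega)

instance : NoZeroDivisors (OrePoly δ) where
  eq_zero_or_eq_zero_of_mul_eq_zero {f g} h := by
    by_contra! hne
    obtain ⟨a, ha, ha'⟩ := exists_leading hne.1
    obtain ⟨b, hb, hb'⟩ := exists_leading hne.2
    exact coeff_mul_top_ne_zero ha hb ha' hb' (by rw [h, coeff_zero])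

instance : Nontrivial (OrePoly δ) :=
  ⟨0, 1, fun h => by simpa [coeff_one] using congrArg (fun f => coeff f 0) h⟩

/-- Right division by a monic Ore polynomial. -/
theorem exists_degLT_sub_mul {g : OrePoly δ} {h : ℕ} (hg : DegLT (h + 1) g)
    (hg1 : g.coeff h = 1) (f : OrePoly δ) : ∃ q, DegLT h (f - q * g) := by
  have key : ∀ m (f : OrePoly δ), DegLT (h + m) f → ∃ q, DegLT h (f - q * g) := by
    intro m
    induction m with
    | zero => exact fun f hf => ⟨0, by simpa using hf⟩
    | succ m ih =>
      intro f hf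
      have htop : (X δ ^ m * g).coeff (h + m) = 1 := by rw [coeff_X_pow_mul hg, hg1, map_one]
      -- Since `g` is monic, so is `∂ᵐ g`; no inversion is needed to cancel the top coefficient.
      obtain ⟨q, hq⟩ := ih (f - (f.coeff (h + m) • X δ ^ m) * g) fun k hk => by
        rw [smul_mul_assoc, coeff_sub, coeff_smul]
        rcases hk.eq_or_lt with rfl | hlt
        · rw [htop, mul_one, sub_self]
        · rw [hf k (by omega), hg.X_pow_mul m k (by omega), mul_zero, sub_zero]
      exact ⟨f.coeff (h + m) • X δ ^ m + q, by rwa [add_mul, ← sub_sub]⟩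
  rcases eq_or_ne f 0 with rfl | hf
  · exact ⟨0, by simpa using DegLT.zero⟩
  · obtain ⟨a, ha, -⟩ := exists_leading hf
    exact key (a + 1) f (ha.mono (by omega))

/-! ### Ore polynomials from coefficient sequences -/

/-- The Ore polynomial `∑ k < m, f k ∂ᵏ`. -/
noncomputable def ofFun (δ : SkewDerivation σ) (m : ℕ) (f : ℕ → F) : OrePoly δ :=
  ∑ k ∈ Finset.range m, monomial δ k (f k)

theorem coeff_ofFun (m : ℕ) (f : ℕ → F) (k : ℕ) :
    (ofFun δ m f).coeff k = if k < m then f k else 0 := by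
  simp [ofFun, coeff_sum, coeff_monomial]

theorem coeff_ofFun_of_lt {m k : ℕ} (f : ℕ → F) (hk : k < m) : (ofFun δ m f).coeff k = f k := by
  rw [coeff_ofFun, if_pos hk]

theorem degLT_ofFun (m : ℕ) (f : ℕ → F) : DegLT m (ofFun δ m f) := fun k hk => by
  rw [coeff_ofFun, if_neg (not_lt.mpr hk)]

theorem ofFun_eq_iff {m : ℕ} {f : ℕ → F} {p : OrePoly δ} (hp : DegLT m p) :
    ofFun δ m f = p ↔ ∀ k < m, f k = p.coeff k := by
  constructor
  · rintro rfl k hk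
    rw [coeff_ofFun_of_lt f hk]
  · intro h
    refine ext_coeff fun k => ?_
    rw [coeff_ofFun]
    split_ifs with hk
    · exact h k hk
    · exact (hp k (not_lt.mp hk)).symm

theorem ofFun_eq_zero_iff {m : ℕ} {f : ℕ → F} : ofFun δ m f = 0 ↔ ∀ k < m, f k = 0 :=
  ofFun_eq_iff DegLT.zero

theorem ofFun_congr {m : ℕ} {f g : ℕ → F} (h : ∀ k < m, f k = g k) :
    ofFun δ m f = ofFun δ m g :=
  (ofFun_eq_iff (degLT_ofFun m g)).mpr fun k hk => by rw [h k hk, coeff_ofFun_of_lt g hk]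

theorem ofFun_sub_mul (m : ℕ) (f g : ℕ → F) (a : F) :
    ofFun δ m (fun k => f k - a * g k) = ofFun δ m f - a • ofFun δ m g :=
  ext_coeff fun k => by
    simp only [coeff_sub, coeff_smul, coeff_ofFun]
    split_ifs <;> simp

theorem ofFun_mul (m : ℕ) (f : ℕ → F) (a : F) :
    ofFun δ m (fun k => a * f k) = a • ofFun δ m f :=
  ext_coeff fun k => by
    simp only [coeff_smul, coeff_ofFun]
    split_ifs <;> simp

/-- The coefficients of `∂ * p`, where `p` has coefficients `f`. -/
theorem ofFun_X_mul {m : ℕ} {f g : ℕ → F} {p : OrePoly δ} (hp : DegLT m p) (hf : ofFun δ (m + 1) f = p)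
    (hg0 : g 0 = δ (f 0)) (hg : ∀ k < m, g (k + 1) = σ (f k) + δ (f (k + 1))) :
    ofFun δ (m + 1) g = X δ * p := by
  rw [ofFun_eq_iff hp.X_mul]
  have hf' := (ofFun_eq_iff (hp.mono (Nat.le_succ m))).mp hf
  rintro (_ | k) hk
  · rw [coeff_X_mul_zero, hg0, hf' 0 hk]
  · rw [coeff_X_mul_succ, hg k (by omega), hf' k (by omega), hf' (k + 1) hk]

end OrePoly

namespace OrePoly

open Matrix

variable {F : Type*} [DivisionRing F] {σ : F ≃+* F} {δ : SkewDerivation σ}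
  {n : ℕ} {A : Matrix (Fin n) (Fin n) (OrePoly δ)} {d : ℕ}

theorem FullRank.vecMul_injective (hA : FullRank A) : Function.Injective fun u => u ᵥ* A :=
  Matrix.vecMul_injective_iff.mpr hA

theorem DegLT.vecMul {a : ℕ} {u : Fin n → OrePoly δ} (hu : ∀ i, DegLT a (u i))
    (hd : ∀ i j, DegLT d (A i j)) (j : Fin n) : DegLT (a + d) ((u ᵥ* A) j) :=
  DegLT.sum fun i _ => (((hu i).mono (Nat.le_succ a)).mul (hd i j))

/-! ### Degree bounds by counting dimensions -/

/-- The Ore polynomial of degree less than `a` with the given coefficients, as a linear map. -/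
noncomputable def ofFin (δ : SkewDerivation σ) (a : ℕ) : (Fin a → F) →ₗ[F] OrePoly δ where
  toFun f := ∑ k, f k • X δ ^ (k : ℕ)
  map_add' f g := by simp only [Pi.add_apply, add_smul, Finset.sum_add_distrib]
  map_smul' c f := by
    simp only [Pi.smul_apply, smul_eq_mul, mul_smul, Finset.smul_sum, RingHom.id_apply]

theorem degLT_X_pow (k : ℕ) : DegLT (k + 1) (X δ ^ k) := by
  have h1 : DegLT 1 (1 : OrePoly δ) := fun k hk => by rw [coeff_one, if_neg (by omega)]
  simpa [add_comm] using h1.X_pow_mul k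

theorem coeff_X_pow (k m : ℕ) : (X δ ^ k).coeff m = if k = m then 1 else 0 := by
  unfold coeff
  rw [← mul_one (X δ ^ k), X_pow_coeffs]
  exact (DFunLike.congr_fun (dMul_pow_one δ k) m).trans Finsupp.single_apply

theorem degLT_ofFin (a : ℕ) (f : Fin a → F) : DegLT a (ofFin δ a f) :=
  DegLT.sum fun k _ => ((degLT_X_pow (k : ℕ)).mono k.2).smul _

theorem coeff_ofFin (a : ℕ) (f : Fin a → F) (k : Fin a) : (ofFin δ a f).coeff k = f k := by
  simp only [ofFin, LinearMap.coe_mk, AddHom.coe_mk, coeff_sum, coeff_smul, coeff_X_pow,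
    mul_ite, mul_one, mul_zero, Fin.val_inj, Finset.sum_ite_eq', Finset.mem_univ, if_true]

theorem ofFin_injective (a : ℕ) : Function.Injective (ofFin δ a) := fun f g h =>
  funext fun k => by rw [← coeff_ofFin (δ := δ) a f k, h, coeff_ofFin]

/-- The row vector `u A - w v`, as a function of the coefficients of `u` and `w`. -/
noncomputable def syzygyMap (A : Matrix (Fin n) (Fin n) (OrePoly δ)) (v : Fin n → OrePoly δ)
    (a b : ℕ) : ((Fin n → Fin a → F) × (Fin b → F)) →ₗ[F] (Fin n → OrePoly δ) where
  toFun p := (fun i => ofFin δ a (p.1 i)) ᵥ* A - fun j => ofFin δ b p.2 * v j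
  map_add' p q := by
    simp only [Prod.fst_add, Prod.snd_add, Pi.add_apply, map_add, add_mul]
    rw [show (fun i => ofFin δ a (p.1 i) + ofFin δ a (q.1 i)) =
      (fun i => ofFin δ a (p.1 i)) + fun i => ofFin δ a (q.1 i) from rfl, Matrix.add_vecMul]
    ext1 j
    simp only [Pi.sub_apply, Pi.add_apply]
    abel
  map_smul' c p := by
    simp only [Prod.smul_fst, Prod.smul_snd, Pi.smul_apply, map_smul, smul_mul_assoc,
      RingHom.id_apply, smul_sub]
    rw [show (fun i => c • ofFin δ a (p.1 i)) = c • fun i => ofFin δ a (p.1 i) from rfl,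
      Matrix.smul_vecMul]
    rfl

/-- The coefficients of `u` and `w` are `n a + n d + 1` unknowns, and the equation `u A = w v`
imposes `n (a + d)` left `F`-linear conditions on them, so a nonzero solution exists. -/
theorem exists_syzygy (hn : 0 < n) (hA : FullRank A) (hd : ∀ i j, DegLT d (A i j)) {e : ℕ}
    {v : Fin n → OrePoly δ} (hv : ∀ j, DegLT (e + 1) (v j)) :
    ∃ (u : Fin n → OrePoly δ) (w : OrePoly δ), w ≠ 0 ∧ u ᵥ* A = w • v ∧
      (∀ i, DegLT (n * d - d + 1 + e) (u i)) ∧ DegLT (n * d + 1) w := by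
  -- The size `a` is chosen so that `u A` and `w v` have the same degree bound `a + d = n d + 1 +
  -- e`.
  set a := n * d - d + 1 + e with ha
  set b := n * d + 1 with hb
  have hnd : d ≤ n * d := Nat.le_mul_of_pos_left d hn
  set c := a + d with hc
  let Φ : ((Fin n → Fin a → F) × (Fin b → F)) →ₗ[F] (Fin n → Fin c → F) :=
    LinearMap.pi fun j => LinearMap.pi fun k =>
      (lcoeff δ (k : ℕ)).comp ((LinearMap.proj j).comp (syzygyMap A v a b))
  have hfin : Module.finrank F (Fin n → Fin c → F) <
      Module.finrank F ((Fin n → Fin a → F) × (Fin b → F)) := by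
    rw [Module.finrank_prod, Module.finrank_pi_fintype F (M := fun _ => Fin c → F),
      Module.finrank_pi_fintype F (M := fun _ => Fin a → F)]
    simp only [Module.finrank_fin_fun, Finset.sum_const, Finset.card_univ, Fintype.card_fin,
      smul_eq_mul]
    rw [hc, hb, mul_add]
    omega
  obtain ⟨p, hp, hp0⟩ := Submodule.exists_mem_ne_zero_of_ne_bot
    (LinearMap.ker_ne_bot_of_finrank_lt (f := Φ) hfin)
  have hu : ∀ i, DegLT a (ofFin δ a (p.1 i)) := fun i => degLT_ofFin a _
  have hw : DegLT b (ofFin δ b p.2) := degLT_ofFin b _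
  have hzero : syzygyMap A v a b p = 0 := by
    ext1 j
    refine ext_coeff fun k => ?_
    by_cases hk : k < c
    · exact congrFun (congrFun (LinearMap.mem_ker.mp hp) j) ⟨k, hk⟩
    · refine DegLT.sub (DegLT.vecMul hu hd j) (DegLT.mono (hw.mul (hv j)) ?_) k (not_lt.mp hk)
      omega
  have heq : (fun i => ofFin δ a (p.1 i)) ᵥ* A = ofFin δ b p.2 • v := sub_eq_zero.mp hzero
  refine ⟨_, _, fun hw0 => hp0 ?_, heq, hu, hw⟩
  -- If `w = 0` then `u A = 0`, and full rank gives `u = 0`, contradicting nontriviality of the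
  -- solution.
  rw [hw0, zero_smul] at heq
  have hu0 := hA.vecMul_injective (heq.trans (Matrix.zero_vecMul A).symm)
  have h1 : p.1 = 0 := funext fun i => ofFin_injective a ((congrFun hu0 i).trans (map_zero _).symm)
  have h2 : p.2 = 0 := ofFin_injective b (hw0.trans (map_zero _).symm)
  exact Prod.ext h1 h2

/-- The syzygy `u' A = w v = (w u) A` forces `u' = w u`, so the bound on `u'` is inherited by `u`.
-/
theorem degLT_of_vecMul_eq (hn : 0 < n) (hA : FullRank A) (hd : ∀ i j, DegLT d (A i j)) {e : ℕ}
    {u v : Fin n → OrePoly δ} (hv : ∀ j, DegLT (e + 1) (v j)) (huv : u ᵥ* A = v) (i : Fin n) :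
    DegLT (n * d - d + 1 + e) (u i) := by
  obtain ⟨u', w, hw, huw, hu', -⟩ := exists_syzygy hn hA hd hv
  have : u' = w • u := hA.vecMul_injective (by
    change u' ᵥ* A = (w • u) ᵥ* A
    rw [huw, Matrix.smul_vecMul, huv])
  have h := hu' i
  rw [this] at h
  exact DegLT.of_mul_left hw h

/-! ### The Hermite form of the row module -/

/-- The left module generated by the rows of `A`. -/
noncomputable def rowModule (A : Matrix (Fin n) (Fin n) (OrePoly δ)) :
    Submodule (OrePoly δ) (Fin n → OrePoly δ) :=
  LinearMap.range (Matrix.vecMulLinear A)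

theorem smul_mem_rowModule (a : F) {v : Fin n → OrePoly δ} (hv : v ∈ rowModule A) :
    a • v ∈ rowModule A := by
  obtain ⟨u, rfl⟩ := hv
  exact ⟨a • u, Matrix.smul_vecMul a u A⟩

theorem vecMul_mem {N : Submodule (OrePoly δ) (Fin n → OrePoly δ)}
    {W : Matrix (Fin n) (Fin n) (OrePoly δ)} (hW : ∀ i, W i ∈ N) (c : Fin n → OrePoly δ) :
    c ᵥ* W ∈ N := by
  rw [Matrix.vecMul_eq_sum]
  exact Submodule.sum_mem _ fun i _ => Submodule.smul_mem _ _ (hW i)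

/-- `H` is the Hermite form of `A`, with diagonal degrees `h`. -/
structure IsHermiteBasis (A H : Matrix (Fin n) (Fin n) (OrePoly δ)) (h : Fin n → ℕ) : Prop where
  mem : ∀ j, H j ∈ rowModule A
  lower : ∀ j b, b < j → H j b = 0
  degLT_diag : ∀ j, DegLT (h j + 1) (H j j)
  coeff_diag : ∀ j, (H j j).coeff (h j) = 1
  degLT_upper : ∀ j b, j < b → DegLT (h b) (H j b)
  minimal : ∀ v ∈ rowModule A, ∀ j, (∀ b < j, v b = 0) → DegLT (h j) (v j) → v j = 0
  le : ∀ j, h j ≤ n * d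

/-- The syzygy of the `j`-th unit vector puts `w eⱼ` into the row module, with `deg w ≤ n d`; it
remains to normalize `w`. -/
theorem exists_monic_mem (hn : 0 < n) (hA : FullRank A) (hd : ∀ i j, DegLT d (A i j))
    (j : Fin n) : ∃ k, k ≤ n * d ∧ ∃ v ∈ rowModule A, (∀ b < j, v b = 0) ∧
      DegLT (k + 1) (v j) ∧ (v j).coeff k = 1 := by
  obtain ⟨u, w, hw, huw, -, hwd⟩ := exists_syzygy hn hA hd (e := 0) (v := Pi.single j 1)
    fun b => by
      rcases eq_or_ne b j with rfl | hb
      · rw [Pi.single_eq_same]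
        exact degLT_X_pow (δ := δ) 0
      · rw [Pi.single_eq_of_ne hb]
        exact DegLT.zero
  obtain ⟨k, hk, hk0⟩ := exists_leading hw
  have hj : (w • (Pi.single j 1 : Fin n → OrePoly δ)) j = w := by simp
  refine ⟨k, ?_, (w.coeff k)⁻¹ • (w • (Pi.single j 1 : Fin n → OrePoly δ)),
    smul_mem_rowModule _ ⟨u, huw⟩, fun b hb => ?_, ?_, ?_⟩
  · by_contra hlt
    exact hk0 (hwd k (by omega))
  · simp [Pi.single_eq_of_ne hb.ne]
  · rw [Pi.smul_apply, hj]
    exact hk.smul _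
  · rw [Pi.smul_apply, hj, coeff_smul, inv_mul_cancel₀ hk0]

/-- Reduction of a row vector modulo an upper triangular system with monic diagonal. -/
theorem exists_reduced {W : Matrix (Fin n) (Fin n) (OrePoly δ)} {h : Fin n → ℕ}
    (lower : ∀ j b, b < j → W j b = 0) (hdeg : ∀ j, DegLT (h j + 1) (W j j))
    (hmon : ∀ j, (W j j).coeff (h j) = 1) (l : ℕ) :
    ∀ m, m + l = n → ∀ v : Fin n → OrePoly δ, ∃ c : Fin n → OrePoly δ,
      (∀ b : Fin n, (b : ℕ) < m → (c ᵥ* W) b = 0) ∧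
        ∀ b : Fin n, m ≤ b → DegLT (h b) ((v - c ᵥ* W) b) := by
  induction l with
  | zero =>
    intro m hm v
    refine ⟨0, fun b _ => by rw [Matrix.zero_vecMul, Pi.zero_apply], fun b hb => ?_⟩
    have := b.2
    omega
  | succ l ih =>
    intro m hm v
    -- Entries are reduced from left to right. The remainder at entry `m` survives, as the later
    -- corrections vanish at all entries up to `m`.
    obtain ⟨q, hq⟩ := exists_degLT_sub_mul (hdeg ⟨m, by omega⟩) (hmon ⟨m, by omega⟩)
      (v ⟨m, by omega⟩)
    obtain ⟨c, hc0, hc⟩ := ih (m + 1) (by omega) (v - q • W ⟨m, by omega⟩)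
    have hmul : (Pi.single ⟨m, by omega⟩ q + c) ᵥ* W = q • W ⟨m, by omega⟩ + c ᵥ* W := by
      rw [Matrix.add_vecMul, Matrix.single_vecMul]
      rfl
    refine ⟨Pi.single ⟨m, by omega⟩ q + c, fun b hb => ?_, fun b hb => ?_⟩
    · rw [hmul, Pi.add_apply, hc0 b (by omega), Pi.smul_apply, lower _ _ (Fin.lt_def.mpr hb),
        smul_zero, add_zero]
    · rw [hmul, ← sub_sub]
      rcases hb.eq_or_lt with rfl | hb
      · rw [Pi.sub_apply, hc0 b (Nat.lt_succ_self _), sub_zero]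
        exact hq
      · exact hc b hb

/-- For each `j`, take a vector of the row module that vanishes before entry `j` and is monic there
of least possible degree, then reduce its later entries by the other vectors of this kind. -/
theorem exists_isHermiteBasis (hn : 0 < n) (hA : FullRank A) (hd : ∀ i j, DegLT d (A i j)) :
    ∃ (H : Matrix (Fin n) (Fin n) (OrePoly δ)) (h : Fin n → ℕ),
      IsHermiteBasis (d := d) A H h := by
  classical
  let T : Fin n → ℕ → Prop := fun j k => ∃ v ∈ rowModule A, (∀ b < j, v b = 0) ∧
    DegLT (k + 1) (v j) ∧ (v j).coeff k = 1
  have hT : ∀ j, ∃ k, T j k := fun j =>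
    let ⟨k, _, hk⟩ := exists_monic_mem hn hA hd j
    ⟨k, hk⟩
  let h : Fin n → ℕ := fun j => Nat.find (hT j)
  have hspec : ∀ j, T j (h j) := fun j => Nat.find_spec (hT j)
  obtain ⟨W, hW⟩ : ∃ W : Matrix (Fin n) (Fin n) (OrePoly δ), ∀ j, W j ∈ rowModule A ∧
      (∀ b < j, W j b = 0) ∧ DegLT (h j + 1) (W j j) ∧ (W j j).coeff (h j) = 1 :=
    ⟨fun j => (hspec j).choose, fun j => (hspec j).choose_spec⟩
  choose hWmem hWlow hWdeg hWmon using hW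
  have hmin : ∀ v ∈ rowModule A, ∀ j, (∀ b < j, v b = 0) → DegLT (h j) (v j) → v j = 0 := by
    intro v hv j hb hdeg
    by_contra hne
    obtain ⟨k, hk, hk0⟩ := exists_leading hne
    have hlt : k < h j := by
      by_contra hle
      exact hk0 (hdeg k (not_lt.mp hle))
    refine Nat.find_min (hT j) hlt ⟨((v j).coeff k)⁻¹ • v, smul_mem_rowModule _ hv, ?_,
      hk.smul _, ?_⟩
    · intro b hbj
      rw [Pi.smul_apply, hb b hbj, smul_zero]
    · rw [Pi.smul_apply, coeff_smul, inv_mul_cancel₀ hk0]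
  have hle : ∀ j, h j ≤ n * d := fun j => by
    obtain ⟨k, hk, hTk⟩ := exists_monic_mem hn hA hd j
    exact (Nat.find_min' (hT j) hTk).trans hk
  -- Starting at `j + 1` leaves entry `j` and everything before it untouched.
  have hred := fun j : Fin n => exists_reduced (W := W) hWlow hWdeg hWmon (n - (j + 1)) (j + 1)
    (by omega) (W j)
  choose c hc0 hc using hred
  have hH : ∀ j b, b ≤ j → (W j - c j ᵥ* W) b = W j b := fun j b hb => by
    rw [Pi.sub_apply, hc0 j b (Nat.lt_succ_of_le hb), sub_zero]
  refine ⟨fun j => W j - c j ᵥ* W, h, ⟨fun j => ?_, fun j b hb => ?_, fun j => ?_, fun j => ?_,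
    fun j b hb => hc j b hb, hmin, hle⟩⟩
  · exact Submodule.sub_mem _ (hWmem j) (vecMul_mem hWmem _)
  · rw [hH j b hb.le, hWlow j b hb]
  · rw [hH j j le_rfl]
    exact hWdeg j
  · rw [hH j j le_rfl]
    exact hWmon j

namespace IsHermiteBasis

variable {H : Matrix (Fin n) (Fin n) (OrePoly δ)} {h : Fin n → ℕ}

theorem isHermite (hH : IsHermiteBasis (d := d) A H h) : IsHermite H where
  upper i j hij := hH.lower i j hij
  monic i := ⟨h i, deg_eq_of_degLT (hH.degLT_diag i) (by rw [hH.coeff_diag]; exact one_ne_zero),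
    hH.coeff_diag i⟩
  reduced i j hij := by
    rw [deg_eq_of_degLT (hH.degLT_diag j) (by rw [hH.coeff_diag]; exact one_ne_zero)]
    exact deg_lt_iff.mpr (hH.degLT_upper i j hij)

/-- The remainder of `v` modulo `H` stays in the row module, and minimality of the diagonal degrees
kills its entries one after the other. -/
theorem exists_vecMul_eq (hH : IsHermiteBasis (d := d) A H h) {v : Fin n → OrePoly δ}
    (hv : v ∈ rowModule A) : ∃ c, c ᵥ* H = v := by
  obtain ⟨c, -, hc⟩ := exists_reduced hH.lower hH.degLT_diag hH.coeff_diag n 0 (zero_add n) v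
  refine ⟨c, ?_⟩
  have hmem : v - c ᵥ* H ∈ rowModule A := Submodule.sub_mem _ hv (vecMul_mem hH.mem c)
  have hzero : ∀ m (b : Fin n), (b : ℕ) = m → (v - c ᵥ* H) b = 0 := by
    intro m
    induction m using Nat.strong_induction_on with
    | _ m ih =>
      rintro b rfl
      exact hH.minimal _ hmem b (fun b' hb' => ih b' hb' b' rfl) (hc b (Nat.zero_le _))
  exact (sub_eq_zero.mp (funext fun b : Fin n => hzero b b rfl)).symm

theorem vecMul_injective (hH : IsHermiteBasis (d := d) A H h) :
    Function.Injective fun c => c ᵥ* H := by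
  intro c c' hcc
  have h0 : (c - c') ᵥ* H = 0 := by rw [Matrix.sub_vecMul]; exact sub_eq_zero.mpr hcc
  have hzero : ∀ m (b : Fin n), (b : ℕ) = m → (c - c') b = 0 := by
    intro m
    induction m using Nat.strong_induction_on with
    | _ m ih =>
      rintro b rfl
      have hb : ((c - c') ᵥ* H) b = (c - c') b * H b b := by
        refine Finset.sum_eq_single b (fun i _ hib => ?_) fun hb => absurd (Finset.mem_univ b) hb
        rcases lt_or_gt_of_ne hib with hlt | hgt
        · rw [ih i hlt i rfl, zero_mul]
        · exact (congrArg _ (hH.lower i b hgt)).trans (mul_zero _)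
      rw [h0, Pi.zero_apply] at hb
      refine (mul_eq_zero.mp hb.symm).resolve_right fun hne => ?_
      have := hH.coeff_diag b
      rw [hne, coeff_zero] at this
      exact zero_ne_one this
  exact sub_eq_zero.mp (funext fun b : Fin n => hzero b b rfl)

/-- With `W H = A` and `U A = H`, cancelling `H` in `U W H = H` and `A` in `W U A = A` makes `W` a
two-sided inverse of `U`. -/
theorem isUnit_of_mul_eq (hH : IsHermiteBasis (d := d) A H h) (hA : FullRank A)
    {U : Matrix (Fin n) (Fin n) (OrePoly δ)} (hU : U * A = H) : IsUnit U := by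
  have hrow : ∀ i, A i ∈ rowModule A := fun i => ⟨Pi.single i 1, Matrix.single_one_vecMul i A⟩
  choose W hW using fun i => hH.exists_vecMul_eq (hrow i)
  have hWH : Matrix.of W * H = A := by
    funext i
    rw [Matrix.mul_apply_eq_vecMul]
    exact hW i
  have cancel : ∀ {B C M : Matrix (Fin n) (Fin n) (OrePoly δ)},
      Function.Injective (fun u => u ᵥ* M) → B * M = C * M → B = C := by
    intro B C M hM hBC
    funext i
    refine hM ?_
    change B i ᵥ* M = C i ᵥ* M
    rw [← Matrix.mul_apply_eq_vecMul, hBC, Matrix.mul_apply_eq_vecMul]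
  refine ⟨⟨U, Matrix.of W, cancel hH.vecMul_injective ?_, cancel hA.vecMul_injective ?_⟩, rfl⟩
  · rw [Matrix.mul_assoc, hWH, hU, Matrix.one_mul]
  · rw [Matrix.mul_assoc, hU, hWH, Matrix.one_mul]

theorem degLT_row (hH : IsHermiteBasis (d := d) A H h) (j b : Fin n) :
    DegLT (n * d + 1) (H j b) := by
  rcases lt_trichotomy b j with hlt | rfl | hgt
  · rw [hH.lower j b hlt]
    exact DegLT.zero
  · exact (hH.degLT_diag b).mono (Nat.succ_le_succ (hH.le b))
  · exact (hH.degLT_upper j b hgt).mono ((hH.le b).trans (Nat.le_succ _))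

end IsHermiteBasis

end OrePoly

namespace OrePoly

open Matrix

variable {F : Type*} [DivisionRing F] {σ : F ≃+* F} {δ : SkewDerivation σ}
  {n K : ℕ} {A : Matrix (Fin n) (Fin n) (OrePoly δ)}

/-! ### Augmented row vectors

A sequence `y : ℕ → ℕ → F` holds `2 n` Ore polynomials with `K` coefficients each: the first `n`
form a row vector, the last `n` the multipliers that express it by the rows of `A`. -/

/-- The row vector held by `y`. -/
noncomputable def rowPart (δ : SkewDerivation σ) (n K : ℕ) (y : ℕ → ℕ → F) : Fin n → OrePoly δ :=
  fun j => ofFun δ K (y j)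

/-- The multipliers held by `y`. -/
noncomputable def multPart (δ : SkewDerivation σ) (n K : ℕ) (y : ℕ → ℕ → F) : Fin n → OrePoly δ :=
  fun i => ofFun δ K (y (n + i))

/-- The multipliers held by `y` express the row vector held by `y`. -/
def IsRelation (A : Matrix (Fin n) (Fin n) (OrePoly δ)) (K : ℕ) (y : ℕ → ℕ → F) : Prop :=
  multPart δ n K y ᵥ* A = rowPart δ n K y

variable {x y z : ℕ → ℕ → F}

theorem rowPart_eq_zero (h : ∀ b < n, ∀ k < K, y b k = 0) : rowPart δ n K y = 0 :=
  funext fun j => ofFun_eq_zero_iff.mpr (h j j.2)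

theorem rowPart_sub_mul {a : F}
    (h : ∀ b < 2 * n, ∀ k < K, z b k = x b k - a * y b k) :
    rowPart δ n K z = rowPart δ n K x - a • rowPart δ n K y :=
  funext fun j => (ofFun_congr (h j (by omega))).trans (ofFun_sub_mul K _ _ a)

theorem multPart_sub_mul {a : F}
    (h : ∀ b < 2 * n, ∀ k < K, z b k = x b k - a * y b k) :
    multPart δ n K z = multPart δ n K x - a • multPart δ n K y :=
  funext fun j => (ofFun_congr (h (n + j) (by omega))).trans (ofFun_sub_mul K _ _ a)

theorem rowPart_mul {a : F} (h : ∀ b < 2 * n, ∀ k < K, z b k = a * y b k) :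
    rowPart δ n K z = a • rowPart δ n K y :=
  funext fun j => (ofFun_congr (h j (by omega))).trans (ofFun_mul K _ a)

theorem multPart_mul {a : F} (h : ∀ b < 2 * n, ∀ k < K, z b k = a * y b k) :
    multPart δ n K z = a • multPart δ n K y :=
  funext fun j => (ofFun_congr (h (n + j) (by omega))).trans (ofFun_mul K _ a)

theorem rowPart_congr (h : ∀ b < 2 * n, ∀ k < K, z b k = y b k) :
    rowPart δ n K z = rowPart δ n K y :=
  funext fun j => ofFun_congr (h j (by omega))

theorem multPart_congr (h : ∀ b < 2 * n, ∀ k < K, z b k = y b k) :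
    multPart δ n K z = multPart δ n K y :=
  funext fun j => ofFun_congr (h (n + j) (by omega))

theorem IsRelation.congr (hy : IsRelation A K y) (h : ∀ b < 2 * n, ∀ k < K, z b k = y b k) :
    IsRelation A K z := by
  rw [IsRelation, rowPart_congr h, multPart_congr h]
  exact hy

theorem IsRelation.sub_mul (hx : IsRelation A K x) (hy : IsRelation A K y) {a : F}
    (h : ∀ b < 2 * n, ∀ k < K, z b k = x b k - a * y b k) : IsRelation A K z := by
  rw [IsRelation, rowPart_sub_mul h, multPart_sub_mul h, Matrix.sub_vecMul, Matrix.smul_vecMul,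
    hx, hy]

theorem IsRelation.mul (hy : IsRelation A K y) {a : F}
    (h : ∀ b < 2 * n, ∀ k < K, z b k = a * y b k) : IsRelation A K z := by
  rw [IsRelation, rowPart_mul h, multPart_mul h, Matrix.smul_vecMul, hy]

theorem IsRelation.rowPart_mem (hy : IsRelation A K y) : rowPart δ n K y ∈ rowModule A :=
  ⟨_, hy⟩

/-! ### Echelon tables -/

/-- Position `(j, k)`, the coefficient of `∂ᵏ` in the `j`-th entry, comes before `(j', k')`. -/
def Before (j k j' k' : ℕ) : Prop := j < j' ∨ j = j' ∧ k' < k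

/-- A table of augmented row vectors: the one at `(j, k)` is zero or has its leading coefficient,
which is `1`, at position `(j, k)`. -/
structure IsEchelon (A : Matrix (Fin n) (Fin n) (OrePoly δ)) (K : ℕ)
    (P : ℕ → ℕ → ℕ → ℕ → F) : Prop where
  relation : ∀ j < n, ∀ k < K, IsRelation A K (P j k)
  pivot : ∀ j < n, ∀ k < K, (∀ j' < n, ∀ k' < K, P j k j' k' = 0) ∨
    P j k j k = 1 ∧ ∀ j' < n, ∀ k' < K, Before j' k' j k → P j k j' k' = 0

/-- The space spanned by the rows of a table. -/
noncomputable def tableSpan (δ : SkewDerivation σ) (n K : ℕ) (P : ℕ → ℕ → ℕ → ℕ → F) :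
    Submodule F (Fin n → OrePoly δ) :=
  Submodule.span F (Set.range fun p : Fin n × Fin K => rowPart δ n K (P p.1 p.2))

variable {P Q : ℕ → ℕ → ℕ → ℕ → F}

theorem rowPart_mem_tableSpan {j k : ℕ} (hj : j < n) (hk : k < K) :
    rowPart δ n K (P j k) ∈ tableSpan δ n K P :=
  Submodule.subset_span ⟨(⟨j, hj⟩, ⟨k, hk⟩), rfl⟩

theorem coeff_rowPart (y : ℕ → ℕ → F) (b : Fin n) {k : ℕ} (hk : k < K) :
    (rowPart δ n K y b).coeff k = y b k :=
  coeff_ofFun_of_lt _ hk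

namespace IsEchelon

theorem eq_one (hP : IsEchelon A K P) {j k : ℕ} (hj : j < n) (hk : k < K)
    (h : P j k j k ≠ 0) : P j k j k = 1 :=
  (hP.pivot j hj k hk).elim (fun h0 => absurd (h0 j hj k hk) h) fun h1 => h1.1

theorem eq_zero (hP : IsEchelon A K P) {j k : ℕ} (hj : j < n) (hk : k < K)
    (h : P j k j k = 0) {j' k' : ℕ} (hj' : j' < n) (hk' : k' < K) : P j k j' k' = 0 :=
  (hP.pivot j hj k hk).elim (fun h0 => h0 j' hj' k' hk')
    fun h1 => absurd (h1.1.symm.trans h) one_ne_zero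

theorem eq_zero_of_before (hP : IsEchelon A K P) {j k j' k' : ℕ} (hj : j < n) (hk : k < K)
    (hj' : j' < n) (hk' : k' < K) (h : Before j' k' j k) : P j k j' k' = 0 :=
  (hP.pivot j hj k hk).elim (fun h0 => h0 j' hj' k' hk') fun h1 => h1.2 j' hj' k' hk' h

/-- The leading position of an element of the span is a pivot position. -/
theorem exists_leading (hP : IsEchelon A K P) {v : Fin n → OrePoly δ}
    (hv : v ∈ tableSpan δ n K P) (hv0 : v ≠ 0) :
    ∃ (j : Fin n) (k : ℕ), k < K ∧ P j k j k ≠ 0 ∧ (v j).coeff k ≠ 0 ∧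
      ∀ (j' : Fin n) (k' : ℕ), k' < K → Before j' k' j k → (v j').coeff k' = 0 := by
  classical
  obtain ⟨c, rfl⟩ := (Submodule.mem_span_range_iff_exists_fun F).mp hv
  -- `T` collects the table rows that really contribute to the combination. The leading positions of
  -- these rows are distinct, so the earliest of them cannot cancel.
  let T : Finset (Fin n × Fin K) :=
    Finset.univ.filter fun p => c p ≠ 0 ∧ P p.1 p.2 p.1 p.2 ≠ 0
  have hcoeff : ∀ (j : Fin n) (k : ℕ), k < K →
      ((∑ p, c p • rowPart δ n K (P p.1 p.2)) j).coeff k = ∑ p, c p * P p.1 p.2 j k := by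
    intro j k hk
    rw [Finset.sum_apply, coeff_sum]
    refine Finset.sum_congr rfl fun p _ => ?_
    rw [Pi.smul_apply, coeff_smul, coeff_rowPart _ _ hk]
  have hout : ∀ p, p ∉ T → ∀ (j : Fin n) (k : ℕ), k < K → c p * P p.1 p.2 j k = 0 := by
    intro p hp j k hk
    simp only [T, Finset.mem_filter, Finset.mem_univ, true_and, not_and_or, not_not] at hp
    rcases hp with hp | hp
    · rw [hp, zero_mul]
    · rw [hP.eq_zero p.1.2 p.2.2 hp j.2 hk, mul_zero]
  have hT : T.Nonempty := by
    by_contra hT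
    rw [Finset.not_nonempty_iff_eq_empty] at hT
    refine hv0 (funext fun j => ext_coeff fun k => ?_)
    by_cases hk : k < K
    · rw [hcoeff j k hk]
      exact Finset.sum_eq_zero fun p _ => hout p (by simp [hT]) j k hk
    · rw [Finset.sum_apply]
      exact DegLT.sum (fun p _ => (degLT_ofFun K _).smul (c p)) k (not_lt.mp hk)
  -- The second component is dualized because higher powers of `∂` come first.
  obtain ⟨p, hpT, hp⟩ := T.exists_min_image
    (fun p => toLex ((p.1 : ℕ), OrderDual.toDual (p.2 : ℕ))) hT
  have hbefore : ∀ q ∈ T, q ≠ p → Before p.1 p.2 q.1 q.2 := by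
    intro q hq hqp
    have := hp q hq
    simp only [Prod.Lex.le_iff, ofLex_toLex, OrderDual.toDual_le_toDual] at this
    rcases this with h | ⟨h1, h2⟩
    · exact Or.inl h
    · refine Or.inr ⟨h1, lt_of_le_of_ne h2 fun h3 => hqp ?_⟩
      exact Prod.ext (Fin.ext h1.symm) (Fin.ext h3)
  have hpT' := (Finset.mem_filter.mp hpT).2
  refine ⟨p.1, p.2, p.2.2, hpT'.2, ?_, fun j k hk hjk => ?_⟩
  · rw [hcoeff _ _ p.2.2, Finset.sum_eq_single p]
    · rw [hP.eq_one p.1.2 p.2.2 hpT'.2, mul_one]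
      exact hpT'.1
    · intro q _ hqp
      by_cases hq : q ∈ T
      · rw [hP.eq_zero_of_before q.1.2 q.2.2 p.1.2 p.2.2 (hbefore q hq hqp), mul_zero]
      · exact hout q hq _ _ p.2.2
    · simp
  · rw [hcoeff j k hk]
    refine Finset.sum_eq_zero fun q _ => ?_
    by_cases hq : q ∈ T
    · have : Before j k q.1 q.2 := by
        rcases eq_or_ne q p with rfl | hqp
        · exact hjk
        · have := hbefore q hq hqp
          unfold Before at *
          omega
      rw [hP.eq_zero_of_before q.1.2 q.2.2 j.2 hk this, mul_zero]
    · exact hout q hq j k hk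

variable {d : ℕ} {H : Matrix (Fin n) (Fin n) (OrePoly δ)} {h : Fin n → ℕ}

/-- A pivot row at `(j, k)` belongs to the row module, vanishes before entry `j` and has degree `k`
there, so minimality of `h j` applies. -/
theorem le_of_pivot (hP : IsEchelon A K P) (hH : IsHermiteBasis (d := d) A H h) {j : Fin n} {k : ℕ}
    (hk : k < K) (hjk : P j k j k ≠ 0) : h j ≤ k := by
  by_contra hlt
  have hdeg : DegLT (h j) (rowPart δ n K (P j k) j) := fun k' hk' => by
    by_cases hk'K : k' < K
    · rw [coeff_rowPart _ _ hk'K]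
      exact hP.eq_zero_of_before j.2 hk j.2 hk'K (Or.inr ⟨rfl, by omega⟩)
    · exact degLT_ofFun K _ k' (not_lt.mp hk'K)
  have h0 := hH.minimal _ (hP.relation j j.2 k hk).rowPart_mem j
    (fun b hb => ofFun_eq_zero_iff.mpr fun k' hk' =>
      hP.eq_zero_of_before j.2 hk b.2 hk' (Or.inl hb)) hdeg
  exact hjk (ofFun_eq_zero_iff.mp h0 k hk)

/-- The leading position of `H j` is `(j, h j)`, and leading positions of vectors of the span are
pivots. Together with `le_of_pivot`, `h j` is the least exponent of a pivot in entry `j`. -/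
theorem pivot_diag_ne_zero (hP : IsEchelon A K P) (hH : IsHermiteBasis (d := d) A H h)
    {j : Fin n} (hj : H j ∈ tableSpan δ n K P) (hK : h j < K) : P j (h j) j (h j) ≠ 0 := by
  have hne : (H j j).coeff (h j) ≠ 0 := by rw [hH.coeff_diag]; exact one_ne_zero
  obtain ⟨j', k, hk, hpiv, hco, hbef⟩ := hP.exists_leading hj fun h0 => hne (by rw [h0]; rfl)
  have h1 : ¬ Before j (h j) j' k := fun hb => hne (hbef j (h j) hK hb)
  have h2 : ¬ j' < j := fun hlt => hco (by rw [hH.lower j j' hlt]; rfl)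
  obtain rfl : j' = j := by
    unfold Before at h1
    rw [Fin.lt_def] at h2
    exact Fin.ext (by omega)
  have h3 : ¬ h j' < k := fun hlt => hco (hH.degLT_diag j' k hlt)
  have h4 : k = h j' := by
    unfold Before at h1
    omega
  rwa [h4] at hpiv

/-- The pivot row at the last pivot position of an entry, reduced at the pivot positions of all
later entries, is a row of the Hermite form. -/
theorem rowPart_eq (hP : IsEchelon A K P) (hH : IsHermiteBasis (d := d) A H h) {j : Fin n}
    (hj : H j ∈ tableSpan δ n K P) (hK : h j < K) (hx : rowPart δ n K x ∈ tableSpan δ n K P)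
    (hxj : ∀ b ≤ j, rowPart δ n K x b = rowPart δ n K (P j (h j)) b)
    (hx0 : ∀ b < n, ∀ k < K, j < b → P b k b k ≠ 0 → x b k = 0) :
    rowPart δ n K x = H j := by
  refine sub_eq_zero.mp ?_
  by_contra hne
  obtain ⟨b, k, hk, hpiv, hco, -⟩ := hP.exists_leading (Submodule.sub_mem _ hx hj) hne
  refine hco ?_
  have hle := hP.le_of_pivot hH hk hpiv
  rw [Pi.sub_apply, coeff_sub]
  -- At the pivot `(b, k)` the two vectors agree: before entry `j` both vanish, in entry `j` both
  -- are monic of degree `h j` and `k ≥ h j`, and after it `x` is cleared while `H j` has degree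
  -- less than `h b ≤ k`.
  rcases lt_trichotomy b j with hlt | rfl | hgt
  · rw [hxj b hlt.le, coeff_rowPart _ _ hk, hH.lower j b hlt, coeff_zero, sub_zero]
    exact hP.eq_zero_of_before j.2 hK b.2 hk (Or.inl hlt)
  · rw [hxj b le_rfl, coeff_rowPart _ _ hk]
    rcases hle.eq_or_lt with rfl | hlt
    · rw [hH.coeff_diag, hP.eq_one b.2 hk hpiv, sub_self]
    · rw [hH.degLT_diag b k hlt, sub_zero]
      exact hP.eq_zero_of_before b.2 hK b.2 hk (Or.inr ⟨rfl, hlt⟩)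
  · rw [coeff_rowPart _ _ hk, hH.degLT_upper j b hgt k hle, sub_zero]
    exact hx0 b b.2 k hk hgt hpiv

end IsEchelon

/-- The multipliers of a vector of degree at most `n d` have degree less than `N`, so finitely many
of the generators `∂ᵗ Aᵢ` suffice, with coefficients in `F`. -/
theorem mem_tableSpan_of_forall_X_pow {N d : ℕ} (hn : 0 < n) (hA : FullRank A)
    (hd : ∀ i j, DegLT d (A i j))
    (hN : n * d - d + 1 + n * d ≤ N)
    (hspan : ∀ i, ∀ t < N, X δ ^ t • A i ∈ tableSpan δ n K P)
    {v : Fin n → OrePoly δ} (hv : v ∈ rowModule A) (hdeg : ∀ j, DegLT (n * d + 1) (v j)) :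
    v ∈ tableSpan δ n K P := by
  obtain ⟨u, rfl⟩ := hv
  have hu : ∀ i, DegLT N (u i) := fun i => (degLT_of_vecMul_eq hn hA hd hdeg rfl i).mono hN
  change u ᵥ* A ∈ _
  rw [Matrix.vecMul_eq_sum]
  refine Submodule.sum_mem _ fun i _ => ?_
  have : u i • A i = ∑ t ∈ Finset.range N, (u i).coeff t • (X δ ^ t • A i) := by
    conv_lhs => rw [eq_sum_X_pow (hu i), Finset.sum_smul]
    simp only [smul_assoc]
  change u i • A i ∈ _
  rw [this]
  exact Submodule.sum_mem _ fun t ht =>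
    Submodule.smul_mem _ _ (hspan i t (Finset.mem_range.mp ht))

/-! ### Inserting a row vector into an echelon table -/

/-- The state of inserting `v` into a table whose span contains `S`: the positions in `Z` have been
cleared, and `x` is congruent to `v` modulo the table. -/
structure Inserting (A : Matrix (Fin n) (Fin n) (OrePoly δ)) (K : ℕ)
    (S : Submodule F (Fin n → OrePoly δ)) (v : Fin n → OrePoly δ) (Z : ℕ → ℕ → Prop)
    (P : ℕ → ℕ → ℕ → ℕ → F) (x : ℕ → ℕ → F) : Prop where
  echelon : IsEchelon A K P
  relation : IsRelation A K x
  le : S ≤ tableSpan δ n K P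
  mem : v - rowPart δ n K x ∈ tableSpan δ n K P
  cleared : ∀ j < n, ∀ k < K, Z j k → x j k = 0

namespace Inserting

variable {S : Submodule F (Fin n → OrePoly δ)} {v : Fin n → OrePoly δ} {Z : ℕ → ℕ → Prop}
  {j k : ℕ}

/-- The pivot row vanishes before `(j, k)`, so the positions already cleared stay cleared. -/
theorem sub_pivot (hI : Inserting A K S v (fun j' k' => Before j' k' j k) P x) (hj : j < n)
    (hk : k < K) (hjk : P j k j k ≠ 0)
    (hz : ∀ b < 2 * n, ∀ l < K, z b l = x b l - x j k * P j k b l) :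
    Inserting A K S v (fun j' k' => Before j' k' j k ∨ j' = j ∧ k' = k) P z where
  echelon := hI.echelon
  relation := hI.relation.sub_mul (hI.echelon.relation j hj k hk) hz
  le := hI.le
  mem := by
    rw [rowPart_sub_mul hz, sub_sub_eq_add_sub, add_sub_right_comm]
    exact Submodule.add_mem _ hI.mem (Submodule.smul_mem _ _ (rowPart_mem_tableSpan hj hk))
  cleared j' hj' k' hk' h := by
    rw [hz j' (by omega) k' hk']
    rcases h with h | ⟨rfl, rfl⟩
    · rw [hI.cleared j' hj' k' hk' h, hI.echelon.eq_zero_of_before hj hk hj' hk' h, mul_zero,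
        sub_zero]
    · rw [hI.echelon.eq_one hj hk hjk, mul_one, sub_self]

/-- All positions before `(j, k)` are already cleared in `x`, so its normalization is an admissible
pivot row. The row it overwrites has zero row part, hence the span does not shrink. -/
theorem store (hI : Inserting A K S v (fun j' k' => Before j' k' j k) P x) (hj : j < n)
    (hk : k < K) (hjk : P j k j k = 0) (hx : x j k ≠ 0)
    (hQ : ∀ b < 2 * n, ∀ l < K, Q j k b l = (x j k)⁻¹ * x b l)
    (hQP : ∀ j' k', ¬ (j' = j ∧ k' = k) → Q j' k' = P j' k') :
    Inserting A K S v (fun j' k' => Before j' k' j k) Q x where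
  echelon := by
    refine ⟨fun j' hj' k' hk' => ?_, fun j' hj' k' hk' => ?_⟩
    · by_cases h : j' = j ∧ k' = k
      · obtain ⟨rfl, rfl⟩ := h
        exact hI.relation.mul hQ
      · rw [hQP j' k' h]
        exact hI.echelon.relation j' hj' k' hk'
    · by_cases h : j' = j ∧ k' = k
      · obtain ⟨rfl, rfl⟩ := h
        refine Or.inr ⟨?_, fun j₁ hj₁ k₁ hk₁ hb => ?_⟩
        · rw [hQ _ (by omega) _ hk, inv_mul_cancel₀ hx]
        · rw [hQ _ (by omega) _ hk₁, hI.cleared j₁ hj₁ k₁ hk₁ hb, mul_zero]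
      · rw [hQP j' k' h]
        exact hI.echelon.pivot j' hj' k' hk'
  relation := hI.relation
  le := hI.le.trans (tableSpan_mono hI hj hk hjk hQP)
  mem := tableSpan_mono hI hj hk hjk hQP hI.mem
  cleared := hI.cleared
where
  tableSpan_mono (hI : Inserting A K S v (fun j' k' => Before j' k' j k) P x) (hj : j < n)
      (hk : k < K) (hjk : P j k j k = 0) (hQP : ∀ j' k', ¬ (j' = j ∧ k' = k) → Q j' k' = P j' k') :
      tableSpan δ n K P ≤ tableSpan δ n K Q := by
    refine Submodule.span_le.mpr ?_
    rintro _ ⟨p, rfl⟩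
    change rowPart δ n K (P p.1 p.2) ∈ tableSpan δ n K Q
    by_cases h : (p.1 : ℕ) = j ∧ (p.2 : ℕ) = k
    · rw [h.1, h.2, rowPart_eq_zero fun j' hj' k' hk' => hI.echelon.eq_zero hj hk hjk hj' hk']
      exact Submodule.zero_mem _
    · rw [← hQP _ _ h]
      exact rowPart_mem_tableSpan p.1.2 p.2.2

theorem mem_of_cleared (hI : Inserting A K S v (fun _ _ => True) P x) :
    v ∈ tableSpan δ n K P := by
  have := hI.mem
  rwa [rowPart_eq_zero fun b hb k hk => hI.cleared b hb k hk trivial, sub_zero] at this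

theorem weaken {Z' : ℕ → ℕ → Prop} (hI : Inserting A K S v Z P x)
    (h : ∀ j < n, ∀ k < K, Z' j k → Z j k) : Inserting A K S v Z' P x :=
  { hI with cleared := fun j hj k hk hz => hI.cleared j hj k hk (h j hj k hk hz) }

end Inserting

/-! ### Reducing a pivot row -/

/-- The state of reducing the table row `P j₀ k₀` at the pivot positions of later entries; those in
`Z` have been cleared. -/
structure Reducing (A : Matrix (Fin n) (Fin n) (OrePoly δ)) (K j₀ k₀ : ℕ) (Z : ℕ → ℕ → Prop)
    (P : ℕ → ℕ → ℕ → ℕ → F) (x : ℕ → ℕ → F) : Prop where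
  relation : IsRelation A K x
  mem : rowPart δ n K x ∈ tableSpan δ n K P
  eq : ∀ b < n, b ≤ j₀ → ∀ k < K, x b k = P j₀ k₀ b k
  cleared : ∀ j < n, ∀ k < K, j₀ < j → Z j k → P j k j k ≠ 0 → x j k = 0

/-- No pivot at `(j, k)` is assumed: a row without pivot has zero row part and changes nothing. The
entries up to `j₀` are safe because rows of later entries vanish there. -/
theorem Reducing.sub_pivot {j₀ k₀ j k : ℕ} (hP : IsEchelon A K P)
    (hI : Reducing A K j₀ k₀ (fun j' k' => Before j' k' j k) P x) (hj : j < n) (hj₀ : j₀ < j)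
    (hk : k < K) (hz : ∀ b < 2 * n, ∀ l < K, z b l = x b l - x j k * P j k b l) :
    Reducing A K j₀ k₀ (fun j' k' => Before j' k' j k ∨ j' = j ∧ k' = k) P z where
  relation := hI.relation.sub_mul (hP.relation j hj k hk) hz
  mem := by
    rw [rowPart_sub_mul hz]
    exact Submodule.sub_mem _ hI.mem (Submodule.smul_mem _ _ (rowPart_mem_tableSpan hj hk))
  eq b hb hbj l hl := by
    rw [hz b (by omega) l hl, hI.eq b hb hbj l hl,
      hP.eq_zero_of_before hj hk hb hl (Or.inl (by omega)), mul_zero, sub_zero]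
  cleared j' hj' k' hk' hlt h hpiv := by
    rw [hz j' (by omega) k' hk']
    rcases h with h | ⟨rfl, rfl⟩
    · rw [hI.cleared j' hj' k' hk' hlt h hpiv, hP.eq_zero_of_before hj hk hj' hk' h, mul_zero,
        sub_zero]
    · rw [hP.eq_one hj hk hpiv, mul_one, sub_self]

theorem Reducing.weaken {j₀ k₀ : ℕ} {Z Z' : ℕ → ℕ → Prop} (hI : Reducing A K j₀ k₀ Z P x)
    (h : ∀ j < n, ∀ k < K, j₀ < j → Z' j k → Z j k) : Reducing A K j₀ k₀ Z' P x :=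
  { hI with cleared := fun j hj k hk hlt hz => hI.cleared j hj k hk hlt (h j hj k hk hlt hz) }

end OrePoly

/-! ### Correctness and cost of programs -/

namespace Memory

variable {F : Type*}

/-- The memory `s'` agrees with `s` on the registers below `r` and on the arrays outside `as`. -/
structure Keeps (r : ℕ) (as : List ℕ) (s s' : Memory F) : Prop where
  reg : ∀ i < r, s'.reg i = s.reg i
  arr : ∀ a, a ∉ as → s'.arr a = s.arr a

theorem Keeps.refl (r : ℕ) (as : List ℕ) (s : Memory F) : Keeps r as s s :=
  ⟨fun _ _ => rfl, fun _ _ => rfl⟩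

theorem Keeps.trans {r r' : ℕ} {as as' : List ℕ} {s s' s'' : Memory F} (h : Keeps r as s s')
    (h' : Keeps r' as' s' s'') (hr : r ≤ r') (has : as' ⊆ as) : Keeps r as s s'' :=
  ⟨fun i hi => (h'.reg i (hi.trans_le hr)).trans (h.reg i hi),
    fun a ha => (h'.arr a fun h => ha (has h)).trans (h.arr a ha)⟩

theorem Keeps.mono {r r' : ℕ} {as as' : List ℕ} {s s' : Memory F} (h : Keeps r as s s')
    (hr : r' ≤ r) (has : as ⊆ as') : Keeps r' as' s s' :=
  (Keeps.refl r' as' s).trans h hr has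

@[simp] theorem reg_setReg (s : Memory F) (r v i : ℕ) :
    (s.setReg r v).reg i = if i = r then v else s.reg i :=
  Function.update_apply _ _ _ _

@[simp] theorem arr_setReg (s : Memory F) (r v : ℕ) : (s.setReg r v).arr = s.arr := rfl

@[simp] theorem reg_set (s : Memory F) (x : Cell) (v : F) : (s.set x v).reg = s.reg := rfl

theorem arr_set (s : Memory F) (x : Cell) (v : F) (a : ℕ) : (s.set x v).arr a =
    if a = x.array then Function.update (s.arr a) (x.idx.map (IndexExpr.eval s.reg)) v
    else s.arr a := by
  unfold set
  split_ifs with h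
  · subst h
    exact Function.update_self _ _ _
  · exact Function.update_of_ne h _ _

theorem keeps_setReg (s : Memory F) {r r' v : ℕ} (as : List ℕ) (h : r' ≤ r) :
    Keeps r' as s (s.setReg r v) :=
  ⟨fun i hi => by rw [reg_setReg, if_neg (by omega)], fun _ _ => rfl⟩

theorem keeps_set (s : Memory F) (r : ℕ) {as : List ℕ} {x : Cell} (v : F) (h : x.array ∈ as) :
    Keeps r as s (s.set x v) :=
  ⟨fun _ _ => rfl, fun a ha => by
    rw [arr_set, if_neg]
    rintro rfl
    exact ha h⟩

end Memory

namespace Prog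

open Memory

variable {F : Type*} [DivisionRing F] {σ : F ≃+* F} {δ : SkewDerivation σ}

/-- Started in `s`, the program ends in a memory with `Q` after at most `c` operations in `F`. -/
def Meets (δ : SkewDerivation σ) (p : Prog) (s : Memory F) (c : ℕ) (Q : Memory F → Prop) : Prop :=
  Q (p.run δ s).1 ∧ (p.run δ s).2 ≤ c

namespace Meets

variable {p q : Prog} {s : Memory F} {c c' : ℕ} {Q Q' : Memory F → Prop}

theorem mono (h : Meets δ p s c Q) (hc : c ≤ c') (hQ : ∀ s', Q s' → Q' s') : Meets δ p s c' Q' :=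
  ⟨hQ _ h.1, h.2.trans hc⟩

theorem imp (h : Meets δ p s c Q) (hQ : ∀ s', Q s' → Q' s') : Meets δ p s c Q' :=
  h.mono le_rfl hQ

theorem skip (h : Q s) : Meets δ .skip s c Q := ⟨h, Nat.zero_le c⟩

theorem setReg {r : ℕ} {e : IndexExpr} (h : Q (s.setReg r (e.eval s.reg))) :
    Meets δ (.setReg r e) s 0 Q := ⟨h, le_rfl⟩

theorem assign {x : Cell} {op : FieldOp} (h : Q (s.set x (op.eval δ s))) :
    Meets δ (.assign x op) s 1 Q := ⟨h, le_rfl⟩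

theorem seq (h : Meets δ p s c fun s' => Meets δ q s' c' Q) : Meets δ (.seq p q) s (c + c') Q :=
  ⟨h.1.1, add_le_add h.2 h.1.2⟩

theorem ifLt {e f : IndexExpr} (h₁ : e.eval s.reg < f.eval s.reg → Meets δ p s c Q)
    (h₂ : ¬ e.eval s.reg < f.eval s.reg → Meets δ q s c Q) : Meets δ (.ifLt e f p q) s c Q := by
  unfold Meets run
  split_ifs with h
  · exact h₁ h
  · exact h₂ h

theorem ifZero {x : Cell} (h₁ : s.get x = 0 → Meets δ p s c Q)
    (h₂ : s.get x ≠ 0 → Meets δ q s c Q) : Meets δ (.ifZero x p q) s (c + 1) Q := by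
  unfold Meets run
  dsimp only
  split_ifs with h
  · exact ⟨(h₁ h).1, Nat.succ_le_succ (h₁ h).2⟩
  · exact ⟨(h₂ h).1, Nat.succ_le_succ (h₂ h).2⟩

theorem loop {r m : ℕ} {e : IndexExpr} (I : ℕ → Memory F → Prop) (hm : e.eval s.reg = m)
    (h0 : I 0 s) (hstep : ∀ t < m, ∀ s', I t s' → Meets δ p (s'.setReg r t) c (I (t + 1))) :
    Meets δ (.loop r e p) s (m * c) (I m) := by
  unfold Meets run
  rw [hm]
  clear hm
  induction m with
  | zero => exact ⟨h0, Nat.zero_le _⟩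
  | succ m ih =>
    have ih := ih fun t ht => hstep t (ht.trans (Nat.lt_succ_self m))
    have hm := hstep m (Nat.lt_succ_self m) _ ih.1
    exact ⟨hm.1, (add_le_add ih.2 hm.2).trans_eq (Nat.succ_mul m c).symm⟩

end Meets

/-- For all `b < 2 n` and `k < K`, kept in the registers `10` and `11`, run the given program. -/
def sweep (p : Prog) : Prog :=
  loop 10 (.mul (.lit 2) (.reg 0)) (loop 11 (.reg 2) p)

/-- The memory `s'` differs from `s` only in one element of the array `a` and in the scratch
array `9`. -/
structure Writes (a : ℕ) (i : List ℕ) (v : F) (s s' : Memory F) : Prop where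
  reg : s'.reg = s.reg
  arr : ∀ a', a' ∉ [a, 9] → s'.arr a' = s.arr a'
  write : s'.arr a = Function.update (s.arr a) i v

theorem meets_sweep {p : Prog} {s : Memory F} {a c n K : ℕ} {i : ℕ → ℕ → List ℕ} {f : ℕ → ℕ → F}
    (hi : ∀ b k b' k', i b k = i b' k' → b = b' ∧ k = k') (hn : s.reg 0 = n) (hK : s.reg 2 = K)
    (h : ∀ b < 2 * n, ∀ k < K, ∀ s', Keeps 10 [a, 9] s s' → s'.reg 10 = b → s'.reg 11 = k →
      s'.arr a (i b k) = s.arr a (i b k) → Meets δ p s' c (Writes a (i b k) (f b k) s')) :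
    Meets δ (sweep p) s (2 * n * (K * c)) fun s' => Keeps 10 [a, 9] s s' ∧
      (∀ b < 2 * n, ∀ k < K, s'.arr a (i b k) = f b k) ∧
      ∀ l, (∀ b k, l ≠ i b k) → s'.arr a l = s.arr a l := by
  -- `Z` is the set of pairs already visited. By injectivity of `i`, the cell of the current pair
  -- still holds its original content, so in-place updates are covered.
  let J : (ℕ → ℕ → Prop) → Memory F → Prop := fun Z s' => Keeps 10 [a, 9] s s' ∧
    (∀ b k, Z b k → s'.arr a (i b k) = f b k) ∧
    ∀ l, (∀ b k, Z b k → l ≠ i b k) → s'.arr a l = s.arr a l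
  refine (Meets.loop (fun b => J fun b' k' => b' < b ∧ k' < K) (by simp [IndexExpr.eval, hn])
    ⟨Keeps.refl _ _ _, fun b k hb => absurd hb.1 (Nat.not_lt_zero b), fun l _ => rfl⟩ ?_).imp ?_
  · intro b hb s₁ h₁
    refine (Meets.loop (fun k s' => s'.reg 10 = b ∧ J (fun b' k' => b' < b ∧ k' < K ∨
      b' = b ∧ k' < k) s') ?_ ⟨by simp, ⟨h₁.1.trans (keeps_setReg _ [] le_rfl) le_rfl (by simp), ?_, ?_⟩⟩
      ?_).imp ?_
    · simp [IndexExpr.eval, h₁.1.reg 2 (by omega), hK]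
    · exact fun b' k' hb' => h₁.2.1 b' k' (by omega)
    · exact fun l hl => h₁.2.2 l fun b' k' hb' => hl b' k' (Or.inl hb')
    · intro k hk s₂ ⟨hb₂, h₂⟩
      refine (h b hb k hk _ (h₂.1.trans (keeps_setReg _ [] (by omega)) le_rfl (by simp))
        (by simpa using hb₂) (by simp) ?_).imp ?_
      · refine h₂.2.2 _ fun b' k' hZ he => ?_
        have := hi _ _ _ _ he
        omega
      · intro s₃ h₃
        refine ⟨by rw [h₃.reg]; simpa using hb₂, ⟨fun r hr => ?_, fun a' ha' => ?_⟩,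
          fun b' k' hZ => ?_, fun l hl => ?_⟩
        · rw [h₃.reg, reg_setReg, if_neg (by omega), h₂.1.reg r hr]
        · rw [h₃.arr a' ha', arr_setReg, h₂.1.arr a' ha']
        · rw [h₃.write, Function.update_apply]
          split_ifs with he
          · rw [(hi _ _ _ _ he).1, (hi _ _ _ _ he).2]
          · refine h₂.2.1 b' k' ?_
            rcases hZ with hZ | ⟨rfl, hZ⟩
            · exact Or.inl hZ
            · refine Or.inr ⟨rfl, lt_of_le_of_ne (Nat.le_of_lt_succ hZ) fun hk' => he ?_⟩
              rw [hk']
        · rw [h₃.write, Function.update_of_ne (hl b k (Or.inr ⟨rfl, Nat.lt_succ_self k⟩))]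
          exact h₂.2.2 l fun b' k' hZ => hl b' k' (by omega)
    · rintro s₂ ⟨-, h₂⟩
      exact ⟨h₂.1, fun b' k' hZ => h₂.2.1 b' k' (by omega),
        fun l hl => h₂.2.2 l fun b' k' hZ => hl b' k' (by omega)⟩
  · intro s' h'
    exact ⟨h'.1, fun b hb k hk => h'.2.1 b k ⟨hb, hk⟩, fun l hl => h'.2.2 l fun b k _ => hl b k⟩

/-! ### The parts of the program

The registers `0`, `1`, `2` hold `n`, `d` and the number of coefficients, `3` a row number, `4` a
power of `∂` (or counts the steps of a search), `5` and `7` a position in the table, `6` counts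
coefficients downwards, `9` holds a pivot position, `10` and `11` are used in sweeps.
Array `0` is the input, `1` and `2` are the outputs, `3` holds the generator `∂ᵗ Aᵢ`, `4` the vector
being reduced, `5` the table, `8` a scalar, and `9` is scratch space. -/

/-- Array `a` at the position of a sweep. -/
abbrev swept (a : ℕ) : Cell := ⟨a, [.reg 10, .reg 11]⟩

/-- A scalar. -/
abbrev scalar (a : ℕ) : Cell := ⟨a, []⟩

/-- Copy the augmented vector in array `a` to array `a'`. -/
def copyVec (a a' : ℕ) : Prog := sweep (assign (swept a') (.copy (swept a)))

/-- Load the input row in register `3`. -/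
def loadRow : Prog :=
  seq (sweep (assign (swept 3) (.copy ⟨0, [.reg 3, .reg 10, .reg 11]⟩)))
    (assign ⟨3, [.add (.reg 0) (.reg 3), .lit 0]⟩ .one)

/-- Multiply the generator by `∂`. -/
def derive : Prog :=
  seq (sweep (seq
      -- The constant coefficient has no `σ`-term, and truncated subtraction would read coefficient
      -- `0` once more.
      (seq (ifLt (.lit 0) (.reg 11)
          (assign (scalar 9) (.sigma ⟨3, [.reg 10, .sub (.reg 11) (.lit 1)]⟩))
          (assign (scalar 9) .zero))
        (assign ⟨9, [.lit 0]⟩ (.delta (swept 3))))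
      (assign (swept 4) (.add (scalar 9) ⟨9, [.lit 0]⟩))))
    -- The product is formed in array `4`, since the new coefficient `l` needs the old coefficient
    -- `l - 1`.
    (copyVec 4 3)

/-- Subtract the multiple of a table row that clears its pivot position. -/
def clearStep : Prog :=
  -- The factor is saved first, because the sweep overwrites the coefficient it is read from.
  seq (assign (scalar 8) (.copy ⟨4, [.reg 5, .reg 7]⟩))
    (sweep (seq (assign (scalar 9) (.mul (scalar 8) ⟨5, [.reg 5, .reg 7, .reg 10, .reg 11]⟩))
      (assign (swept 4) (.sub (swept 4) (scalar 9)))))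

/-- Store the normalized vector in the table. -/
def store : Prog :=
  seq (assign (scalar 8) (.inv ⟨4, [.reg 5, .reg 7]⟩))
    (sweep (assign ⟨5, [.reg 5, .reg 7, .reg 10, .reg 11]⟩ (.mul (scalar 8) (swept 4))))

/-- Set register `7` to the coefficient counted by register `r`. -/
def setCoeff (r r' : ℕ) : Prog := setReg r' (.sub (.sub (.reg 2) (.lit 1)) (.reg r))

/-- Treat one position when a vector is inserted into the table. -/
def insertStep : Prog :=
  -- Right after `store`, the table row is a multiple of the vector, so `clearStep` turns the vector
  -- into zero and the remaining positions are skipped.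
  ifZero ⟨4, [.reg 5, .reg 7]⟩ skip
    (seq (ifZero ⟨5, [.reg 5, .reg 7, .reg 5, .reg 7]⟩ store skip) clearStep)

/-- Insert a vector into the table. -/
def insert : Prog :=
  loop 5 (.reg 0) (loop 6 (.reg 2) (seq (setCoeff 6 7) insertStep))

/-- Insert all generators obtained from the row in register `3` into the table. -/
def insertRow : Prog :=
  -- The exponents `t < 2 n d` suffice by the bound on the multipliers of the Hermite form.
  seq loadRow (loop 4 (.mul (.lit 2) (.mul (.reg 0) (.reg 1)))
    (seq (copyVec 3 4) (seq insert derive)))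

/-- Find the last pivot position of the entry in register `3`. -/
def findPivot : Prog :=
  -- Exponents are visited in descending order, so the last assignment records the least pivot
  -- exponent.
  loop 4 (.reg 2)
    (ifZero ⟨5, [.reg 3, .sub (.sub (.reg 2) (.lit 1)) (.reg 4), .reg 3,
      .sub (.sub (.reg 2) (.lit 1)) (.reg 4)]⟩ skip (setCoeff 4 9))

/-- Clear the pivot positions of all entries after the one in register `3`. -/
def reduce : Prog :=
  -- No zero test is made: where there is no pivot, the row part of the table row is zero.
  loop 5 (.reg 0) (ifLt (.reg 3) (.reg 5) (loop 6 (.reg 2) (seq (setCoeff 6 7) clearStep)) skip)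

/-- Compute the row of the Hermite form with the number in register `3`. -/
def hermiteRow : Prog :=
  seq findPivot (seq
    (sweep (assign (swept 4) (.copy ⟨5, [.reg 3, .reg 9, .reg 10, .reg 11]⟩)))
    (seq reduce (seq
      (sweep (assign ⟨2, [.reg 3, .reg 10, .reg 11]⟩ (.copy (swept 4))))
      (sweep (assign ⟨1, [.reg 3, .reg 10, .reg 11]⟩
        (.copy ⟨4, [.add (.reg 0) (.reg 10), .reg 11]⟩))))))

/-- Compute the Hermite form. -/
def hermite : Prog :=
  -- All vectors `∂ᵗ Aᵢ` with `t ≤ 2 n d` have degree less than `d + 2 n d ≤ 3 n d`, apart from the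
  -- last, unused product, which is still computed within its bound.
  seq (setReg 2 (.mul (.lit 3) (.mul (.reg 0) (.reg 1))))
    (seq (loop 3 (.reg 0) insertRow) (loop 3 (.reg 0) hermiteRow))

end Prog

namespace Memory

variable {F : Type*}

/-- The augmented vector held by array `a`. -/
def vec (s : Memory F) (a b k : ℕ) : F := s.arr a [b, k]

/-- The table of augmented vectors held by array `5`. -/
def table (s : Memory F) (j k b l : ℕ) : F := s.arr 5 [j, k, b, l]

theorem Keeps.vec {r : ℕ} {as : List ℕ} {s s' : Memory F} (h : Keeps r as s s') {a : ℕ}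
    (ha : a ∉ as) : s'.vec a = s.vec a := by
  unfold Memory.vec
  rw [h.arr a ha]

theorem Keeps.table {r : ℕ} {as : List ℕ} {s s' : Memory F} (h : Keeps r as s s')
    (ha : 5 ∉ as) : s'.table = s.table := by
  unfold Memory.table
  rw [h.arr 5 ha]

end Memory

/-! ### Specifications of the vector operations and of insertion -/

namespace Prog

open Memory OrePoly Matrix

variable {F : Type*} [DivisionRing F] {σ : F ≃+* F} {δ : SkewDerivation σ}

theorem meets_sweep_assign {a : ℕ} {e : List IndexExpr} {op : FieldOp} {s : Memory F} {n K : ℕ}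
    {i : ℕ → ℕ → List ℕ} {f : ℕ → ℕ → F}
    (hi : ∀ b k b' k', i b k = i b' k' → b = b' ∧ k = k') (hn : s.reg 0 = n) (hK : s.reg 2 = K)
    (he : ∀ s' : Memory F, Keeps 10 [a, 9] s s' →
      e.map (IndexExpr.eval s'.reg) = i (s'.reg 10) (s'.reg 11))
    (hf : ∀ s' : Memory F, Keeps 10 [a, 9] s s' → op.eval δ s' = f (s'.reg 10) (s'.reg 11)) :
    Meets δ (sweep (assign ⟨a, e⟩ op)) s (2 * n * (K * 1)) fun s' => Keeps 10 [a, 9] s s' ∧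
      (∀ b < 2 * n, ∀ k < K, s'.arr a (i b k) = f b k) ∧
      ∀ l, (∀ b k, l ≠ i b k) → s'.arr a l = s.arr a l := by
  refine meets_sweep hi hn hK fun b _ k _ s' hs' hb hk _ => Meets.assign ⟨rfl, ?_, ?_⟩
  · exact (keeps_set s' 0 _ (List.mem_cons_self (a := a))).arr
  · rw [arr_set, if_pos rfl, he s' hs', hf s' hs', hb, hk]

theorem meets_copyVec {a a' : ℕ} (ha : a ∉ [a', 9]) {s : Memory F} {n K : ℕ}
    (hn : s.reg 0 = n) (hK : s.reg 2 = K) :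
    Meets δ (copyVec a a') s (2 * n * (K * 1)) fun s' => Keeps 10 [a', 9] s s' ∧
      ∀ b < 2 * n, ∀ k < K, s'.vec a' b k = s.vec a b k := by
  refine (meets_sweep_assign (i := fun b k => [b, k]) (f := s.vec a) (by simp) hn hK
    (fun _ _ => rfl) fun s' hs' => ?_).imp fun s' hs' => ⟨hs'.1, hs'.2.1⟩
  rw [← hs'.vec ha]
  rfl

theorem meets_clearStep {s : Memory F} {n K j k : ℕ} (hn : s.reg 0 = n) (hK : s.reg 2 = K)
    (hj : s.reg 5 = j) (hk : s.reg 7 = k) :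
    Meets δ clearStep s (1 + 2 * n * (K * 2)) fun s' => Keeps 10 [4, 8, 9] s s' ∧
      ∀ b < 2 * n, ∀ l < K, s'.vec 4 b l = s.vec 4 b l - s.vec 4 j k * s.table j k b l := by
  refine Meets.seq (Meets.assign ?_)
  set s₁ := s.set (scalar 8) (FieldOp.eval δ s (.copy ⟨4, [.reg 5, .reg 7]⟩)) with hs₁
  have h₁ : Keeps 10 [8] s s₁ := keeps_set s 10 _ (by simp)
  have h8 : s₁.arr 8 [] = s.vec 4 j k := by
    rw [hs₁, arr_set, if_pos rfl]
    simp [FieldOp.eval, Memory.get, IndexExpr.eval, Memory.vec, hj, hk]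
  refine (meets_sweep (a := 4) (i := fun b k => [b, k])
    (f := fun b l => s.vec 4 b l - s.vec 4 j k * s.table j k b l) (by simp)
    ((h₁.reg 0 (by omega)).trans hn) ((h₁.reg 2 (by omega)).trans hK) ?_).imp ?_
  · intro b _ l _ s₂ h₂ hb hl hcell
    refine Meets.seq (c := 1) (c' := 1) (Meets.assign (Meets.assign ⟨rfl, fun a' ha' => ?_, ?_⟩))
    · simp only [List.mem_cons, List.not_mem_nil, or_false, not_or] at ha'
      simp [arr_set, ha'.1, ha'.2]
    · have h5 : s₂.reg 5 = j := by rw [h₂.reg 5 (by omega), h₁.reg 5 (by omega), hj]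
      have h7 : s₂.reg 7 = k := by rw [h₂.reg 7 (by omega), h₁.reg 7 (by omega), hk]
      have ha8 : s₂.arr 8 [] = s.vec 4 j k := by rw [h₂.arr 8 (by simp), h8]
      have ha5 : s₂.arr 5 = s.arr 5 := by rw [h₂.arr 5 (by simp), h₁.arr 5 (by simp)]
      have ha4 : s₂.arr 4 [b, l] = s.vec 4 b l := by rw [hcell, h₁.arr 4 (by simp)]; rfl
      simp [arr_set, FieldOp.eval, Memory.get, IndexExpr.eval, hb, hl, h5, h7, ha8, ha5, ha4,
        Memory.table]
  · exact fun s' h' => ⟨(h₁.mono le_rfl (by simp)).trans h'.1 le_rfl (by simp), h'.2.1⟩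

theorem meets_store {s : Memory F} {n K j k : ℕ} (hn : s.reg 0 = n) (hK : s.reg 2 = K)
    (hj : s.reg 5 = j) (hk : s.reg 7 = k) :
    Meets δ store s (1 + 2 * n * (K * 1)) fun s' => Keeps 10 [5, 8, 9] s s' ∧
      (∀ b < 2 * n, ∀ l < K, s'.table j k b l = (s.vec 4 j k)⁻¹ * s.vec 4 b l) ∧
      ∀ j' k', ¬ (j' = j ∧ k' = k) → s'.table j' k' = s.table j' k' := by
  refine Meets.seq (Meets.assign ?_)
  set s₁ := s.set (scalar 8) (FieldOp.eval δ s (.inv ⟨4, [.reg 5, .reg 7]⟩)) with hs₁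
  have h₁ : Keeps 10 [8] s s₁ := keeps_set s 10 _ (by simp)
  have h8 : s₁.arr 8 [] = (s.vec 4 j k)⁻¹ := by
    rw [hs₁, arr_set, if_pos rfl]
    simp [FieldOp.eval, Memory.get, IndexExpr.eval, Memory.vec, hj, hk]
  refine (meets_sweep_assign (i := fun b l => [j, k, b, l])
    (f := fun b l => (s.vec 4 j k)⁻¹ * s.vec 4 b l) (by simp)
    ((h₁.reg 0 (by omega)).trans hn) ((h₁.reg 2 (by omega)).trans hK) ?_ ?_).imp ?_
  · intro s₂ h₂
    simp [IndexExpr.eval, h₂.reg, h₁.reg, hj, hk]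
  · intro s₂ h₂
    rw [← h8, ← h₁.vec (a := 4) (by simp), ← h₂.vec (a := 4) (by simp), ← h₂.arr 8 (by simp)]
    rfl
  · refine fun s' h' => ⟨(h₁.mono le_rfl (by simp)).trans h'.1 le_rfl (by simp), h'.2.1,
      fun j' k' hne => ?_⟩
    funext b l
    refine (h'.2.2 [j', k', b, l] fun b' l' he => hne ?_).trans ?_
    · simp only [List.cons.injEq] at he
      exact ⟨he.1, he.2.1⟩
    · rw [h₁.arr 5 (by simp)]
      rfl

theorem meets_setCoeff {s : Memory F} {K r r' : ℕ} {Q : Memory F → Prop} (hK : s.reg 2 = K)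
    (h : Q (s.setReg r' (K - 1 - s.reg r))) : Meets δ (setCoeff r r') s 0 Q := by
  refine Meets.setReg ?_
  simpa [IndexExpr.eval, hK] using h

variable {n K : ℕ} {A : Matrix (Fin n) (Fin n) (OrePoly δ)}

theorem meets_insertStep {S : Submodule F (Fin n → OrePoly δ)} {v : Fin n → OrePoly δ}
    {s : Memory F} {j k : ℕ} (hn : s.reg 0 = n) (hK : s.reg 2 = K) (hj : s.reg 5 = j)
    (hk : s.reg 7 = k) (hjn : j < n) (hkK : k < K)
    (hI : Inserting A K S v (fun j' k' => Before j' k' j k) s.table (s.vec 4)) :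
    Meets δ insertStep s (((1 + 2 * n * (K * 1) + 1) + (1 + 2 * n * (K * 2))) + 1) fun s' =>
      Keeps 10 [4, 5, 8, 9] s s' ∧
      Inserting A K S v (fun j' k' => Before j' k' j k ∨ j' = j ∧ k' = k) s'.table (s'.vec 4) := by
  have hx : s.get ⟨4, [.reg 5, .reg 7]⟩ = s.vec 4 j k := by
    simp [Memory.get, IndexExpr.eval, Memory.vec, hj, hk]
  have hP : s.get ⟨5, [.reg 5, .reg 7, .reg 5, .reg 7]⟩ = s.table j k j k := by
    simp [Memory.get, IndexExpr.eval, Memory.table, hj, hk]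
  refine Meets.ifZero (fun h0 => Meets.skip ⟨Keeps.refl _ _ _, ?_⟩) fun h0 => Meets.seq ?_
  · rw [hx] at h0
    refine { hI with cleared := fun j' hj' k' hk' h => ?_ }
    rcases h with h | ⟨rfl, rfl⟩
    · exact hI.cleared j' hj' k' hk' h
    · exact h0
  · rw [hx] at h0
    refine (Meets.ifZero (Q := fun s' => Keeps 10 [5, 8, 9] s s' ∧ s'.table j k j k ≠ 0 ∧
      Inserting A K S v (fun j' k' => Before j' k' j k) s'.table (s'.vec 4))
      (fun hp => (meets_store hn hK hj hk).imp fun s' hs' => ?_)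
      fun hp => Meets.skip ⟨Keeps.refl _ _ _, ?_, hI⟩).imp ?_
    · rw [hP] at hp
      refine ⟨hs'.1, ?_, ?_⟩
      · rw [hs'.2.1 j (by omega) k hkK, inv_mul_cancel₀ h0]
        exact one_ne_zero
      · rw [hs'.1.vec (by simp)]
        exact hI.store hjn hkK hp h0 hs'.2.1 hs'.2.2
    · rwa [hP] at hp
    · rintro s₁ ⟨h₁, hp, hI₁⟩
      refine (meets_clearStep ((h₁.reg 0 (by omega)).trans hn) ((h₁.reg 2 (by omega)).trans hK)
        ((h₁.reg 5 (by omega)).trans hj) ((h₁.reg 7 (by omega)).trans hk)).imp fun s' hs' =>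
        ⟨(h₁.mono le_rfl (by simp)).trans hs'.1 le_rfl (by simp), ?_⟩
      rw [hs'.1.table (by simp)]
      exact hI₁.sub_pivot hjn hkK hp hs'.2

theorem meets_insert {S : Submodule F (Fin n → OrePoly δ)} {v : Fin n → OrePoly δ}
    {s : Memory F} (hn : s.reg 0 = n) (hK : s.reg 2 = K)
    (hI : Inserting A K S v (fun _ _ => False) s.table (s.vec 4)) :
    Meets δ insert s
      (n * (K * (0 + (((1 + 2 * n * (K * 1) + 1) + (1 + 2 * n * (K * 2))) + 1)))) fun s' =>
      Keeps 5 [4, 5, 8, 9] s s' ∧ Inserting A K S v (fun _ _ => True) s'.table (s'.vec 4) := by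
  refine (Meets.loop (fun j s' => Keeps 5 [4, 5, 8, 9] s s' ∧
    Inserting A K S v (fun j' _ => j' < j) s'.table (s'.vec 4)) (by simpa [IndexExpr.eval] using hn)
    ⟨Keeps.refl _ _ _, hI.weaken fun j' _ k' _ h => absurd h (Nat.not_lt_zero _)⟩ ?_).imp
    fun s' hs' => ⟨hs'.1, hs'.2.weaken fun j' hj' _ _ _ => hj'⟩
  rintro j hj s₁ ⟨h₁, hI₁⟩
  -- After `e` steps the `e` highest exponents of entry `j` are done, that is, those with `K ≤ k' +
  -- e`.
  refine (Meets.loop (fun e s' => Keeps 5 [4, 5, 8, 9] s s' ∧ s'.reg 5 = j ∧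
    Inserting A K S v (fun j' k' => j' < j ∨ j' = j ∧ K ≤ k' + e) s'.table (s'.vec 4))
    (m := K) ?_ ⟨h₁.trans (keeps_setReg _ [] le_rfl) le_rfl (by simp), by simp, ?_⟩ ?_).imp ?_
  · simpa [IndexExpr.eval, h₁.reg] using hK
  · exact hI₁.weaken fun j' _ k' hk' h => by omega
  · rintro e he s₂ ⟨h₂, hj₂, hI₂⟩
    refine Meets.seq (meets_setCoeff (K := K) (by simp [h₂.reg, hK]) ?_)
    set s₃ := (s₂.setReg 6 e).setReg 7 (K - 1 - (s₂.setReg 6 e).reg 6) with hs₃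
    have h₃ : Keeps 5 [4, 5, 8, 9] s s₃ := (h₂.trans (keeps_setReg _ [] (by omega)) le_rfl
      (by simp)).trans (keeps_setReg _ [] (by omega)) le_rfl (by simp)
    refine (meets_insertStep (j := j) (k := K - 1 - e) ((h₃.reg 0 (by omega)).trans hn)
      ((h₃.reg 2 (by omega)).trans hK) (by simp [hs₃, hj₂]) (by simp [hs₃]) hj (by omega)
      (hI₂.weaken fun j' _ k' _ h => ?_)).imp fun s' hs' =>
      ⟨h₃.trans hs'.1 (by omega) (by simp), ?_, ?_⟩
    · unfold Before at h
      omega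
    · rw [hs'.1.reg 5 (by omega)]
      simp [hs₃, hj₂]
    · refine hs'.2.weaken fun j' _ k' _ h => ?_
      unfold Before
      omega
  · exact fun s' hs' => ⟨hs'.1, hs'.2.2.weaken fun j' _ k' _ h => by omega⟩

end Prog

/-! ### Specifications of the generators, the pivot search and the Hermite rows -/

namespace Prog

open Memory OrePoly Matrix

variable {F : Type*} [DivisionRing F] {σ : F ≃+* F} {δ : SkewDerivation σ}
  {n d K : ℕ} {A : Matrix (Fin n) (Fin n) (OrePoly δ)}

theorem meets_loadRow {s : Memory F} {i : Fin n} (hn : s.reg 0 = n) (hK : s.reg 2 = K)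
    (hi : s.reg 3 = i) (hA : s.arr 0 = (input n d A).arr 0) (hd : ∀ i j, DegLT d (A i j))
    (hK0 : 0 < K) (hdK : d ≤ K) :
    Meets δ loadRow s (2 * n * (K * 1) + 1) fun s' => Keeps 10 [3, 9] s s' ∧
      rowPart δ n K (s'.vec 3) = A i ∧ multPart δ n K (s'.vec 3) = Pi.single i 1 := by
  refine Meets.seq ((meets_sweep_assign (i := fun b k => [b, k])
    (f := fun b k => s.arr 0 [i, b, k]) (by simp) hn hK (fun _ _ => rfl) fun s' hs' => ?_).imp ?_)
  · simp [FieldOp.eval, Memory.get, IndexExpr.eval, hs'.arr, hs'.reg, hi]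
  rintro s₁ ⟨h₁, hv, -⟩
  refine Meets.assign ⟨h₁.trans (keeps_set _ 10 _ (by simp)) le_rfl (List.Subset.refl _), ?_⟩
  set s₂ := s₁.set ⟨3, [.add (.reg 0) (.reg 3), .lit 0]⟩ (FieldOp.eval δ s₁ .one) with hs₂
  have hvec : ∀ b < 2 * n, ∀ k < K, s₂.vec 3 b k =
      if b = n + i ∧ k = 0 then 1 else s.arr 0 [i, b, k] := by
    intro b hb k hk
    rw [Memory.vec, hs₂, arr_set, if_pos rfl, Function.update_apply, hv b hb k hk]
    simp [IndexExpr.eval, h₁.reg, hn, hi, FieldOp.eval]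
  constructor
  · funext j
    refine (ofFun_eq_iff ((hd i j).mono hdK)).mpr fun k hk => ?_
    rw [hvec j (by omega) k hk, if_neg (by omega), hA]
    simp only [input]
    by_cases hkd : k < d
    · rw [dif_pos ⟨i.2, j.2, hkd⟩]
    · rw [dif_neg (by omega), hd i j k (not_lt.mp hkd)]
  · funext j
    -- The input array is zero outside its range, so the sweep over `2 n` entries has filled the
    -- multiplier half with zeros.
    have h0 : ∀ k, (input n d A).arr 0 [i, n + j, k] = 0 := fun k => by
      simp only [input]
      exact dif_neg (by omega)
    rcases eq_or_ne j i with rfl | hji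
    · rw [Pi.single_eq_same]
      refine (ofFun_eq_iff fun k hk => ?_).mpr fun k hk => ?_
      · rw [coeff_one, if_neg (by omega)]
      · rw [hvec (n + j) (by omega) k hk, hA, h0, coeff_one]
        simp [eq_comm]
    · rw [Pi.single_eq_of_ne hji]
      refine ofFun_eq_zero_iff.mpr fun k hk => ?_
      rw [hvec (n + j) (by omega) k hk, hA, h0, if_neg]
      exact fun h => hji (Fin.ext (by omega))

theorem meets_derive {s : Memory F} {u v : Fin n → OrePoly δ} (hn : s.reg 0 = n)
    (hK : s.reg 2 = K + 1) (hv : rowPart δ n (K + 1) (s.vec 3) = v)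
    (hu : multPart δ n (K + 1) (s.vec 3) = u) (hvK : ∀ j, DegLT K (v j)) (huK : ∀ i, DegLT K (u i)) :
    Meets δ derive s (2 * n * ((K + 1) * 3) + 2 * n * ((K + 1) * 1)) fun s' =>
      Keeps 10 [3, 4, 9] s s' ∧ rowPart δ n (K + 1) (s'.vec 3) = X δ • v ∧
        multPart δ n (K + 1) (s'.vec 3) = X δ • u := by
  refine Meets.seq ((meets_sweep (a := 4) (i := fun b k => [b, k]) (f := fun b l =>
    (if 0 < l then σ (s.vec 3 b (l - 1)) else 0) + δ (s.vec 3 b l)) (by simp) hn hK ?_).imp ?_)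
  · intro b _ l _ s₁ h₁ hb hl hcell
    have ha : s₁.arr 3 = s.arr 3 := h₁.arr 3 (by simp)
    refine Meets.seq (c := 2) (c' := 1) (Meets.seq (c := 1) (c' := 1)
      (Meets.ifLt (fun h => ?_) fun h => ?_))
    all_goals
      rw [show IndexExpr.eval s₁.reg (.reg 11) = l from hl] at h
      refine Meets.assign (Meets.assign (Meets.assign ⟨rfl, fun a' ha' => ?_, ?_⟩))
      · simp only [List.mem_cons, List.not_mem_nil, or_false, not_or] at ha'
        simp [arr_set, ha'.1, ha'.2]
      · simp only [IndexExpr.eval] at h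
        simp [arr_set, FieldOp.eval, Memory.get, IndexExpr.eval, hb, hl, ha, Memory.vec, h]
  rintro s₁ ⟨h₁, hs₁, -⟩
  refine (meets_copyVec (by simp) ((h₁.reg 0 (by omega)).trans hn)
    ((h₁.reg 2 (by omega)).trans hK)).imp ?_
  rintro s₂ ⟨h₂, hs₂⟩
  have hval : ∀ b < 2 * n, ∀ l < K + 1, s₂.vec 3 b l =
      (if 0 < l then σ (s.vec 3 b (l - 1)) else 0) + δ (s.vec 3 b l) := fun b hb l hl => by
    rw [hs₂ b hb l hl]
    exact hs₁ b hb l hl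
  have key : ∀ b < 2 * n, ∀ p : OrePoly δ, DegLT K p → ofFun δ (K + 1) (s.vec 3 b) = p →
      ofFun δ (K + 1) (s₂.vec 3 b) = X δ * p := by
    intro b hb p hp hbp
    refine ofFun_X_mul hp hbp ?_ fun k hk => ?_
    · rw [hval b hb 0 (by omega), if_neg (by omega), zero_add]
    · rw [hval b hb (k + 1) (by omega), if_pos (by omega), Nat.add_sub_cancel]
  refine ⟨(h₁.mono le_rfl (by simp)).trans h₂ le_rfl (by simp), funext fun j => ?_,
    funext fun j => ?_⟩
  · exact key j (by omega) (v j) (hvK j) (congrFun hv j)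
  · exact key (n + j) (by omega) (u j) (huK j) (congrFun hu j)

theorem degLT_X_pow_smul {v : Fin n → OrePoly δ} {m : ℕ} (hv : ∀ j, DegLT m (v j)) (t : ℕ)
    (j : Fin n) : DegLT (m + t) ((X δ ^ t • v) j) :=
  (hv j).X_pow_mul t

theorem degLT_single (i j : Fin n) : DegLT 1 ((Pi.single i 1 : Fin n → OrePoly δ) j) := by
  rcases eq_or_ne j i with rfl | hji
  · rw [Pi.single_eq_same]
    exact degLT_X_pow (δ := δ) 0
  · rw [Pi.single_eq_of_ne hji]
    exact DegLT.zero

theorem meets_insertRow {s : Memory F} {i : Fin n} (hn : s.reg 0 = n) (hd : s.reg 1 = d)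
    (hK : s.reg 2 = K + 1) (hi : s.reg 3 = i) (hA : s.arr 0 = (input n d A).arr 0)
    (hdeg : ∀ i j, DegLT d (A i j)) (hd0 : 0 < d) (hdK : d + 2 * (n * d) ≤ K + 1)
    (hP : IsEchelon A (K + 1) s.table) :
    Meets δ insertRow s (2 * n * ((K + 1) * 1) + 1 + 2 * (n * d) * (2 * n * ((K + 1) * 1) +
      (n * ((K + 1) * (0 + (((1 + 2 * n * ((K + 1) * 1) + 1) + (1 + 2 * n * ((K + 1) * 2))) + 1))) +
        (2 * n * ((K + 1) * 3) + 2 * n * ((K + 1) * 1))))) fun s' =>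
      Keeps 4 [3, 4, 5, 8, 9] s s' ∧ IsEchelon A (K + 1) s'.table ∧
        tableSpan δ n (K + 1) s.table ≤ tableSpan δ n (K + 1) s'.table ∧
        ∀ t < 2 * (n * d), X δ ^ t • A i ∈ tableSpan δ n (K + 1) s'.table := by
  refine Meets.seq ((meets_loadRow hn hK hi hA hdeg (by omega) (by omega)).imp ?_)
  rintro s₁ ⟨h₁, hr₁, hm₁⟩
  refine (Meets.loop (fun t s' => Keeps 4 [3, 4, 5, 8, 9] s s' ∧ IsEchelon A (K + 1) s'.table ∧
    tableSpan δ n (K + 1) s.table ≤ tableSpan δ n (K + 1) s'.table ∧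
    rowPart δ n (K + 1) (s'.vec 3) = X δ ^ t • A i ∧
    multPart δ n (K + 1) (s'.vec 3) = X δ ^ t • Pi.single i 1 ∧
    ∀ t' < t, X δ ^ t' • A i ∈ tableSpan δ n (K + 1) s'.table)
    (by simp [IndexExpr.eval, h₁.reg, hn, hd])
    ⟨h₁.mono (by omega) (by simp), ?_, ?_, ?_, ?_, by simp⟩ ?_).imp
    fun s' h' => ⟨h'.1, h'.2.1, h'.2.2.1, h'.2.2.2.2.2⟩
  · rwa [h₁.table (by simp)]
  · rw [h₁.table (by simp)]
  · rw [hr₁, pow_zero, one_smul]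
  · rw [hm₁, pow_zero, one_smul]
  rintro t ht s₂ ⟨h₂, hP₂, hle₂, hr₂, hm₂, hmem₂⟩
  have h₂' : Keeps 4 [3, 4, 5, 8, 9] s (s₂.setReg 4 t) :=
    h₂.trans (keeps_setReg _ [] le_rfl) le_rfl (by simp)
  refine Meets.seq ((meets_copyVec (a := 3) (a' := 4) (by simp) ((h₂'.reg 0 (by omega)).trans hn)
    ((h₂'.reg 2 (by omega)).trans hK)).imp ?_)
  rintro s₃ ⟨h₃, hcopy⟩
  have h₃' : Keeps 4 [3, 4, 5, 8, 9] s s₃ := h₂'.trans h₃ (by omega) (by simp)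
  have htab : s₃.table = s₂.table := h₃.table (by simp)
  have hvec : s₃.vec 3 = s₂.vec 3 := h₃.vec (by simp)
  have hrel : IsRelation A (K + 1) (s₂.vec 3) := by
    rw [IsRelation, hr₂, hm₂, Matrix.smul_vecMul, Matrix.single_one_vecMul]
    rfl
  refine Meets.seq ((meets_insert (S := tableSpan δ n (K + 1) s₂.table) (v := X δ ^ t • A i)
    ((h₃'.reg 0 (by omega)).trans hn) ((h₃'.reg 2 (by omega)).trans hK)
    ⟨?_, hrel.congr hcopy, ?_, ?_, fun _ _ _ _ h => h.elim⟩).imp ?_)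
  · rwa [htab]
  · rw [htab]
  · rw [rowPart_congr hcopy, ← hr₂]
    exact (sub_self (rowPart δ n (K + 1) (s₂.vec 3))).symm ▸ Submodule.zero_mem _
  rintro s₄ ⟨h₄, hI₄⟩
  have h₄' : Keeps 4 [3, 4, 5, 8, 9] s s₄ := h₃'.trans h₄ (by omega) (by simp)
  refine (meets_derive ((h₄'.reg 0 (by omega)).trans hn) ((h₄'.reg 2 (by omega)).trans hK)
    (v := X δ ^ t • A i) (u := X δ ^ t • Pi.single i 1) ?_ ?_ ?_ ?_).imp ?_
  · rw [h₄.vec (by simp), hvec, hr₂]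
  · rw [h₄.vec (by simp), hvec, hm₂]
  -- Since `t < 2 n d`, the bound `d + t` is at most `K`, which leaves room for one more factor `∂`
  -- among `K + 1` coefficients.
  · exact fun j => (degLT_X_pow_smul (hdeg i) t j).mono (by omega)
  · exact fun j => (degLT_X_pow_smul (degLT_single i) t j).mono (by omega)
  rintro s₅ ⟨h₅, hr₅, hm₅⟩
  refine ⟨h₄'.trans h₅ (by omega) (by simp), ?_, ?_, ?_, ?_, ?_⟩
  · rw [h₅.table (by simp)]
    exact hI₄.echelon
  · rw [h₅.table (by simp)]
    exact hle₂.trans hI₄.le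
  · rw [hr₅, smul_smul, pow_succ']
  · rw [hm₅, smul_smul, pow_succ']
  · intro t' ht'
    rw [h₅.table (by simp)]
    rcases (Nat.le_of_lt_succ ht').eq_or_lt with rfl | hlt
    · exact hI₄.mem_of_cleared
    · exact hI₄.le (hmem₂ t' hlt)

theorem meets_findPivot {s : Memory F} {j h : ℕ} (hK : s.reg 2 = K) (hj : s.reg 3 = j)
    (hh : h < K) (hpiv : s.table j h j h ≠ 0) (hmin : ∀ k < h, s.table j k j k = 0) :
    Meets δ findPivot s (K * 1) fun s' => Keeps 4 [] s s' ∧ s'.reg 9 = h := by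
  -- Exponent `h` is visited at step `K - 1 - h`. From then on register `9` holds `h`, as smaller
  -- exponents carry no pivot.
  refine (Meets.loop (fun t s' => Keeps 4 [] s s' ∧ (K ≤ h + t → s'.reg 9 = h))
    (by simpa [IndexExpr.eval] using hK) ⟨Keeps.refl _ _ _, fun h' => by omega⟩ ?_).imp
    fun s' h' => ⟨h'.1, h'.2 (by omega)⟩
  rintro t ht s₁ ⟨h₁, hreg⟩
  have h₂ : Keeps 4 [] s (s₁.setReg 4 t) :=
    h₁.trans (keeps_setReg _ [] le_rfl) le_rfl (by simp)
  have hget : (s₁.setReg 4 t).get ⟨5, [.reg 3, .sub (.sub (.reg 2) (.lit 1)) (.reg 4), .reg 3,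
      .sub (.sub (.reg 2) (.lit 1)) (.reg 4)]⟩ = s.table j (K - 1 - t) j (K - 1 - t) := by
    simp [Memory.get, IndexExpr.eval, Memory.table, h₁.reg, hK, hj, h₁.arr]
  refine Meets.ifZero (fun h0 => Meets.skip ⟨h₂, fun hle => ?_⟩) fun h0 =>
    meets_setCoeff (K := K) ((h₂.reg 2 (by omega)).trans hK)
      ⟨h₂.trans (keeps_setReg _ [] (by omega)) le_rfl (by simp), fun hle => ?_⟩
  · rw [hget] at h0
    have hne : K - 1 - t ≠ h := fun he => hpiv (by rwa [he] at h0)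
    simpa using hreg (by omega)
  · rw [hget] at h0
    have : ¬ K - 1 - t < h := fun hlt => h0 (hmin _ hlt)
    simp only [reg_setReg, if_true]
    omega

theorem meets_reduce {s : Memory F} {j₀ k₀ : ℕ} (hn : s.reg 0 = n) (hK : s.reg 2 = K)
    (hj₀ : s.reg 3 = j₀) (hP : IsEchelon A K s.table)
    (hI : Reducing A K j₀ k₀ (fun _ _ => False) s.table (s.vec 4)) :
    Meets δ reduce s (n * (K * (0 + (1 + 2 * n * (K * 2))))) fun s' => Keeps 5 [4, 8, 9] s s' ∧
      Reducing A K j₀ k₀ (fun _ _ => True) s.table (s'.vec 4) := by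
  refine (Meets.loop (fun j s' => Keeps 5 [4, 8, 9] s s' ∧
    Reducing A K j₀ k₀ (fun j' _ => j' < j) s.table (s'.vec 4)) (by simpa [IndexExpr.eval] using hn)
    ⟨Keeps.refl _ _ _, hI.weaken fun j' _ k' _ _ h => absurd h (Nat.not_lt_zero _)⟩ ?_).imp
    fun s' hs' => ⟨hs'.1, hs'.2.weaken fun j' hj' _ _ _ _ => hj'⟩
  rintro j hj s₁ ⟨h₁, hI₁⟩
  have h₁' : Keeps 5 [4, 8, 9] s (s₁.setReg 5 j) :=
    h₁.trans (keeps_setReg _ [] le_rfl) le_rfl (by simp)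
  have he₃ : IndexExpr.eval (s₁.setReg 5 j).reg (.reg 3) = j₀ :=
    (h₁'.reg 3 (by omega)).trans hj₀
  have he₅ : IndexExpr.eval (s₁.setReg 5 j).reg (.reg 5) = j := by simp [IndexExpr.eval]
  refine Meets.ifLt (fun hlt => ?_) fun hlt => Meets.skip ⟨h₁', ?_⟩
  · rw [he₃, he₅] at hlt
    refine (Meets.loop (fun e s' => Keeps 5 [4, 8, 9] s s' ∧ s'.reg 5 = j ∧
      Reducing A K j₀ k₀ (fun j' k' => j' < j ∨ j' = j ∧ K ≤ k' + e) s.table (s'.vec 4))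
      (m := K) ?_ ⟨h₁', he₅, ?_⟩ ?_).imp ?_
    · exact (h₁'.reg 2 (by omega)).trans hK
    · exact hI₁.weaken fun j' _ k' hk' _ h => by omega
    · rintro e he s₂ ⟨h₂, hj₂, hI₂⟩
      refine Meets.seq (meets_setCoeff (K := K) (by simp [h₂.reg, hK]) ?_)
      set s₃ := (s₂.setReg 6 e).setReg 7 (K - 1 - (s₂.setReg 6 e).reg 6) with hs₃
      have h₃ : Keeps 5 [4, 8, 9] s s₃ := (h₂.trans (keeps_setReg _ [] (by omega)) le_rfl
        (by simp)).trans (keeps_setReg _ [] (by omega)) le_rfl (by simp)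
      refine (meets_clearStep (j := j) (k := K - 1 - e) ((h₃.reg 0 (by omega)).trans hn)
        ((h₃.reg 2 (by omega)).trans hK) (by simp [hs₃, hj₂]) (by simp [hs₃])).imp
        fun s' hs' => ⟨h₃.trans hs'.1 (by omega) (by simp), ?_, ?_⟩
      · rw [hs'.1.reg 5 (by omega)]
        simp [hs₃, hj₂]
      · have hI₃ : Reducing A K j₀ k₀ (fun j' k' => Before j' k' j (K - 1 - e)) s.table
            (s₃.vec 4) := hI₂.weaken fun j' _ k' _ _ h => by
          unfold Before at h
          omega
        rw [h₃.table (by simp)] at hs'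
        refine (hI₃.sub_pivot hP hj hlt (by omega) hs'.2).weaken fun j' _ k' _ _ h => ?_
        unfold Before
        omega
    · exact fun s' hs' => ⟨hs'.1, hs'.2.2.weaken fun j' _ k' _ _ h => by omega⟩
  · rw [he₃, he₅] at hlt
    exact hI₁.weaken fun j' _ k' _ _ h => by omega

theorem meets_hermiteRow {s : Memory F} {H : Matrix (Fin n) (Fin n) (OrePoly δ)} {h : Fin n → ℕ}
    {j : Fin n} (hn : s.reg 0 = n) (hK : s.reg 2 = K) (hj : s.reg 3 = j)
    (hP : IsEchelon A K s.table) (hH : IsHermiteBasis (d := d) A H h)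
    (hmem : H j ∈ tableSpan δ n K s.table) (hhK : h j < K) :
    Meets δ hermiteRow s (K * 1 + (2 * n * (K * 1) + (n * (K * (0 + (1 + 2 * n * (K * 2)))) +
      (2 * n * (K * 1) + 2 * n * (K * 1))))) fun s' =>
      Keeps 4 [1, 2, 4, 8, 9] s s' ∧
      (∀ i b k : ℕ, i ≠ (j : ℕ) → s'.arr 1 [i, b, k] = s.arr 1 [i, b, k] ∧
        s'.arr 2 [i, b, k] = s.arr 2 [i, b, k]) ∧
      (fun b : Fin n => ofFun δ K fun k => s'.arr 2 [j, b, k]) = H j ∧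
      (fun b : Fin n => ofFun δ K fun k => s'.arr 1 [j, b, k]) ᵥ* A = H j := by
  have hpiv := hP.pivot_diag_ne_zero hH hmem hhK
  refine Meets.seq ((meets_findPivot hK hj hhK hpiv fun k hk => ?_).imp ?_)
  · by_contra hne
    exact absurd (hP.le_of_pivot hH (hk.trans hhK) hne) (not_le.mpr hk)
  rintro s₁ ⟨h₁, h9⟩
  have hn₁ := (h₁.reg 0 (by omega)).trans hn
  have hK₁ := (h₁.reg 2 (by omega)).trans hK
  have hj₁ := (h₁.reg 3 (by omega)).trans hj
  refine Meets.seq ((meets_sweep_assign (i := fun b k => [b, k]) (f := s.table j (h j)) (by simp)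
    hn₁ hK₁ (fun _ _ => rfl) fun s' hs' => ?_).imp ?_)
  · rw [← h₁.table (by simp), ← hs'.table (by simp)]
    simp [FieldOp.eval, Memory.get, IndexExpr.eval, Memory.table, hs'.reg, hj₁, h9]
  rintro s₂ ⟨h₂, hx₂, -⟩
  have h₂' : Keeps 4 [4, 9] s s₂ := (h₁.mono le_rfl (by simp)).trans h₂ (by omega) (by simp)
  have htab : s₂.table = s.table := h₂'.table (by simp)
  refine Meets.seq ((meets_reduce (A := A) (j₀ := j) (k₀ := h j) ((h₂'.reg 0 (by omega)).trans hn)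
    ((h₂'.reg 2 (by omega)).trans hK) ((h₂'.reg 3 (by omega)).trans hj) (by rwa [htab])
    ⟨(hP.relation j j.2 _ hhK).congr hx₂, ?_, ?_, fun _ _ _ _ _ h => h.elim⟩).imp ?_)
  · rw [htab, rowPart_congr (z := s₂.vec 4) (y := s.table j (h j)) hx₂]
    exact rowPart_mem_tableSpan j.2 hhK
  · intro b hb _ k hk
    rw [htab]
    exact hx₂ b (by omega) k hk
  rintro s₃ ⟨h₃, hI₃⟩
  rw [htab] at hI₃
  have h₃' : Keeps 4 [4, 8, 9] s s₃ := (h₂'.mono le_rfl (by simp)).trans h₃ (by omega) (by simp)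
  have hrow : rowPart δ n K (s₃.vec 4) = H j :=
    hP.rowPart_eq hH hmem hhK hI₃.mem
      (fun b hb => ofFun_congr (hI₃.eq b b.2 hb))
      fun b hb k hk hlt hne => hI₃.cleared b hb k hk hlt trivial hne
  refine Meets.seq ((meets_sweep_assign (i := fun b k => [(j : ℕ), b, k]) (f := s₃.vec 4) (by simp)
    ((h₃'.reg 0 (by omega)).trans hn) ((h₃'.reg 2 (by omega)).trans hK) (fun s' hs' => ?_)
    fun s' hs' => ?_).imp ?_)
  · simp [IndexExpr.eval, hs'.reg, h₃'.reg, hj]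
  · rw [← hs'.vec (by simp)]
    rfl
  rintro s₄ ⟨h₄, hH₄, hH₄'⟩
  have h₄' : Keeps 4 [2, 4, 8, 9] s s₄ := (h₃'.mono le_rfl (by simp)).trans h₄ (by omega) (by simp)
  refine (meets_sweep_assign (i := fun b k => [(j : ℕ), b, k])
    (f := fun b k => s₃.vec 4 (n + b) k) (by simp)
    ((h₄'.reg 0 (by omega)).trans hn) ((h₄'.reg 2 (by omega)).trans hK) (fun s' hs' => ?_)
    fun s' hs' => ?_).imp ?_
  · simp [IndexExpr.eval, hs'.reg, h₄'.reg, hj]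
  · rw [← h₄.vec (by simp), ← hs'.vec (by simp)]
    simp [FieldOp.eval, Memory.get, IndexExpr.eval, Memory.vec, hs'.reg, h₄'.reg, hn]
  rintro s₅ ⟨h₅, hU₅, hU₅'⟩
  refine ⟨(h₄'.mono le_rfl (by simp)).trans h₅ (by omega) (by simp), fun i b k hij => ⟨?_, ?_⟩,
    ?_, ?_⟩
  · rw [hU₅' _ (by simp [hij]), h₄'.arr 1 (by simp)]
  · rw [h₅.arr 2 (by simp), hH₄' _ (by simp [hij]), h₃'.arr 2 (by simp)]
  · rw [← hrow, h₅.arr 2 (by simp)]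
    exact funext fun b => ofFun_congr fun k hk => hH₄ b (by omega) k hk
  · rw [← hrow, ← hI₃.relation]
    congr 1
    exact funext fun b => ofFun_congr fun k hk => hU₅ b (by omega) k hk

end Prog

/-! ### Total cost and correctness of the whole program -/

namespace Prog

open Memory OrePoly Matrix

variable {F : Type*} [DivisionRing F] {σ : F ≃+* F} {δ : SkewDerivation σ}
  {n d : ℕ} {A : Matrix (Fin n) (Fin n) (OrePoly δ)}

/-- With `D = n d`, the left side is a polynomial in `n` and `D` each of whose monomials is at most
`n³ D³`; its coefficients sum to `259`. -/
theorem hermite_cost_le {n D : ℕ} (hn : 0 < n) (hD : 0 < D) :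
    n * (2 * n * (3 * D * 1) + 1 + 2 * D * (2 * n * (3 * D * 1) +
      (n * (3 * D * (0 + (((1 + 2 * n * (3 * D * 1) + 1) + (1 + 2 * n * (3 * D * 2))) + 1))) +
        (2 * n * (3 * D * 3) + 2 * n * (3 * D * 1))))) +
    n * (3 * D * 1 + (2 * n * (3 * D * 1) + (n * (3 * D * (0 + (1 + 2 * n * (3 * D * 2)))) +
      (2 * n * (3 * D * 1) + 2 * n * (3 * D * 1))))) ≤ 259 * (n ^ 3 * D ^ 3) := by
  -- Shifting both variables by one leaves a difference with nonnegative coefficients only.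
  obtain ⟨n, rfl⟩ := Nat.exists_eq_add_of_lt hn
  obtain ⟨D, rfl⟩ := Nat.exists_eq_add_of_lt hD
  zify
  rw [← sub_nonneg]
  ring_nf
  positivity

theorem isEchelon_input {K : ℕ} : IsEchelon A K (input n d A).table where
  relation j _ k _ := by
    have h0 : (input n d A).table j k = fun _ _ => 0 := rfl
    have h1 : multPart δ n K (fun _ _ => (0 : F)) = 0 :=
      funext fun i => ofFun_eq_zero_iff.mpr fun _ _ => rfl
    rw [h0, IsRelation, h1, Matrix.zero_vecMul, rowPart_eq_zero fun _ _ _ _ => rfl]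
  pivot _ _ _ _ := Or.inl fun _ _ _ _ => rfl

theorem meets_hermite {H : Matrix (Fin n) (Fin n) (OrePoly δ)} {h : Fin n → ℕ} (hn : 0 < n)
    (hd : 0 < d) (hA : FullRank A) (hdeg : ∀ i j, DegLT d (A i j))
    (hH : IsHermiteBasis (d := d) A H h) :
    Meets δ hermite (input n d A) (259 * (n ^ 3 * (n * d) ^ 3)) fun s =>
      output δ n s 2 = H ∧ output δ n s 1 * A = H := by
  have hnd : 0 < n * d := Nat.mul_pos hn hd
  have hdn : d ≤ n * d := Nat.le_mul_of_pos_left d hn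
  obtain ⟨K, hK⟩ : ∃ K, 3 * (n * d) = K + 1 := ⟨3 * (n * d) - 1, by omega⟩
  refine Meets.mono (Meets.seq (Meets.setReg (Meets.seq ?_)))
    ((zero_add _).trans_le (hermite_cost_le hn hnd)) fun s hs => hs
  rw [hK]
  set s₀ := (input n d A).setReg 2 (IndexExpr.eval (input n d A).reg
    (.mul (.lit 3) (.mul (.reg 0) (.reg 1)))) with hs₀
  have hn₀ : s₀.reg 0 = n := rfl
  have hd₀ : s₀.reg 1 = d := rfl
  have hK₀ : s₀.reg 2 = K + 1 := hK
  refine (Meets.loop (fun i s => Keeps 3 [3, 4, 5, 8, 9] s₀ s ∧ IsEchelon A (K + 1) s.table ∧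
    ∀ i' : Fin n, (i' : ℕ) < i → ∀ t < 2 * (n * d),
      X δ ^ t • A i' ∈ tableSpan δ n (K + 1) s.table) (m := n) ?_
    ⟨Keeps.refl _ _ _, isEchelon_input (d := d), fun i' h => absurd h (Nat.not_lt_zero _)⟩ ?_).imp ?_
  · exact hn₀
  · rintro i hi s₁ ⟨h₁, hP₁, hspan₁⟩
    have h₁' : Keeps 3 [3, 4, 5, 8, 9] s₀ (s₁.setReg 3 i) :=
      h₁.trans (keeps_setReg _ [] le_rfl) le_rfl (by simp)
    refine (meets_insertRow (i := ⟨i, hi⟩) ((h₁'.reg 0 (by omega)).trans hn₀)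
      ((h₁'.reg 1 (by omega)).trans hd₀) ((h₁'.reg 2 (by omega)).trans hK₀) (by simp)
      (h₁'.arr 0 (by simp)) hdeg hd (by omega) hP₁).imp ?_
    rintro s₂ ⟨h₂, hP₂, hle, hspan⟩
    refine ⟨h₁'.trans h₂ (by omega) (List.Subset.refl _), hP₂, fun i' hi' t ht => ?_⟩
    rcases (Nat.le_of_lt_succ hi').eq_or_lt with heq | hlt
    · obtain rfl : i' = ⟨i, hi⟩ := Fin.ext heq
      exact hspan t ht
    · exact hle (hspan₁ i' hlt t ht)
  rintro s₁ ⟨h₁, hP, hspan⟩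
  have hmem : ∀ j, H j ∈ tableSpan δ n (K + 1) s₁.table := fun j =>
    -- The multipliers have degree less than `n d - d + 1 + n d`, which is at most `2 n d` because
    -- `d ≥ 1`.
    mem_tableSpan_of_forall_X_pow (N := 2 * (n * d)) (d := d) hn hA hdeg (by omega)
      (fun i t ht => hspan i i.2 t ht) (hH.mem j) (hH.degLT_row j)
  refine (Meets.loop (fun j s => Keeps 3 [1, 2, 4, 8, 9] s₁ s ∧ ∀ j' : Fin n, (j' : ℕ) < j →
    (fun b : Fin n => ofFun δ (K + 1) fun k => s.arr 2 [j', b, k]) = H j' ∧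
    (fun b : Fin n => ofFun δ (K + 1) fun k => s.arr 1 [j', b, k]) ᵥ* A = H j')
    (m := n) ?_ ⟨Keeps.refl _ _ _, fun j' h => absurd h (Nat.not_lt_zero _)⟩ ?_).imp ?_
  · exact (h₁.reg 0 (by omega)).trans hn₀
  · rintro j hj s₂ ⟨h₂, hrows⟩
    have h₂' : Keeps 3 [1, 2, 4, 8, 9] s₁ (s₂.setReg 3 j) :=
      h₂.trans (keeps_setReg _ [] le_rfl) le_rfl (by simp)
    have htab : (s₂.setReg 3 j).table = s₁.table := h₂'.table (by simp)
    refine (meets_hermiteRow (j := ⟨j, hj⟩) (K := K + 1)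
      ((h₂'.reg 0 (by omega)).trans ((h₁.reg 0 (by omega)).trans hn₀))
      ((h₂'.reg 2 (by omega)).trans ((h₁.reg 2 (by omega)).trans hK₀)) (by simp)
      (by rwa [htab]) hH (by rw [htab]; exact hmem _) ?_).imp ?_
    · have := hH.le ⟨j, hj⟩
      omega
    rintro s₃ ⟨h₃, hkeep, hHrow, hUrow⟩
    refine ⟨h₂'.trans h₃ (by omega) (List.Subset.refl _), fun j' hj' => ?_⟩
    rcases (Nat.le_of_lt_succ hj').eq_or_lt with heq | hlt
    · obtain rfl : j' = ⟨j, hj⟩ := Fin.ext heq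
      exact ⟨hHrow, hUrow⟩
    · simp only [(hkeep j' _ _ hlt.ne).1, (hkeep j' _ _ hlt.ne).2]
      exact hrows j' hlt
  rintro s₂ ⟨h₂, hrows⟩
  have hK₂ : s₂.reg 2 = K + 1 :=
    (h₂.reg 2 (by omega)).trans ((h₁.reg 2 (by omega)).trans hK₀)
  constructor
  · funext j
    refine Eq.trans ?_ (hrows j j.2).1
    unfold output
    rw [hK₂]
    rfl
  · funext j
    rw [Matrix.mul_apply_eq_vecMul]
    refine Eq.trans ?_ (hrows j j.2).2
    unfold output
    rw [hK₂]
    rfl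

end Prog

namespace OrePoly

theorem FullRank.degree_pos {F : Type*} [DivisionRing F] {σ : F ≃+* F} {δ : SkewDerivation σ}
    {n d : ℕ} {A : Matrix (Fin n) (Fin n) (OrePoly δ)} (hA : FullRank A) (hn : 0 < n)
    (hd : ∀ i j, DegLT d (A i j)) : 0 < d := by
  rcases Nat.eq_zero_or_pos d with rfl | h
  · have h0 : A.row ⟨0, hn⟩ = 0 := funext fun j => (hd ⟨0, hn⟩ j).eq_zero
    exact (LinearIndependent.ne_zero ⟨0, hn⟩ hA h0).elim
  · exact h

end OrePoly

theorem mainTheorem5 :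
    ∃ (p : Prog) (C : ℝ),
      ∀ (F : Type*) [DivisionRing F] (σ : F ≃+* F) (δ : SkewDerivation σ) (n d : ℕ)
        (A : Matrix (Fin n) (Fin n) (OrePoly δ)),
        0 < n → OrePoly.FullRank A → (∀ i j, (A i j).deg < (d : WithBot ℕ)) →
          let result := p.run δ (OrePoly.input n d A)
          let U := OrePoly.output δ n result.1 1
          let H := OrePoly.output δ n result.1 2
          IsUnit U ∧ U * A = H ∧ OrePoly.IsHermite H ∧
            (result.2 : ℝ) ≤ C * (n : ℝ) ^ 7 * (d : ℝ) ^ 3 * max 1 (Real.log ((n : ℝ) * d)) := by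
  refine ⟨Prog.hermite, 259, fun F _ σ δ n d A hn hA hdeg => ?_⟩
  replace hdeg : ∀ i j, OrePoly.DegLT d (A i j) := fun i j => OrePoly.deg_lt_iff.mp (hdeg i j)
  have hd := hA.degree_pos hn hdeg
  obtain ⟨H, h, hH⟩ := OrePoly.exists_isHermiteBasis hn hA hdeg
  obtain ⟨⟨hout, hmul⟩, hcost⟩ := Prog.meets_hermite hn hd hA hdeg hH
  refine ⟨hH.isUnit_of_mul_eq hA hmul, hmul.trans hout.symm, hout ▸ hH.isHermite, ?_⟩
  have hn1 : (1 : ℝ) ≤ n := by exact_mod_cast hn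
  -- The operation count is `O(n⁶ d³)`; the additional factor `n` and the logarithm are slack.
  calc ((Prog.hermite.run δ (OrePoly.input n d A)).2 : ℝ)
      ≤ 259 * ((n : ℝ) ^ 3 * ((n : ℝ) * d) ^ 3) := by exact_mod_cast hcost
    _ = 259 * (n : ℝ) ^ 6 * (d : ℝ) ^ 3 * 1 := by ring
    _ ≤ 259 * (n : ℝ) ^ 7 * (d : ℝ) ^ 3 * max 1 (Real.log ((n : ℝ) * d)) := by
      gcongr
      · norm_num
      · exact le_max_left _ _
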